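/- For a finite simple graph $G$ and an integer $k\ge 0$, call a subgraph $H$ of $G$ $k$-edge-colorable if its edges can be assigned colors from a set of $k$ colors so that adjacent edges receive different colors, and let $$\nu_k(G)=\max\{|E(H)| : H \text{ is a } k\text{-edge-colorable subgraph of } G\}.$$ Then $\nu_k(G)$ can be computed in polynomial time for bipartite graphs $G$: there are a deterministic Turing machine (with finitely many stacks) and a polynomial $p$ such that, for every finite bipartite simple graph $G$ with vertex set $\{0,\dots,n-1\}$, given by its adjacency matrix (no bipartition is given), and every integer $k\ge 0$, given in binary, the machine on input $(G,k)$ outputs $\nu_k(G)$ in binary after at most $p(N)$ steps, where $N$ is the length of the encoded input. -/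

import Mathlib

/-- A graph, given as a subgraph `H` of some simple graph, is `k`-edge-colorable if its edges can be
assigned colors from a set of `k` colors so that distinct edges sharing an endpoint receive
different colors. -/
def KEdgeColorable {V : Type*} {G : SimpleGraph V} (H : G.Subgraph) (k : ℕ) : Prop :=
  ∃ c : H.edgeSet → Fin k, ∀ e f : H.edgeSet, e ≠ f →
    (∃ v : V, v ∈ (e : Sym2 V) ∧ v ∈ (f : Sym2 V)) → c e ≠ c f

/-- The set of all numbers `|E(H)|`, where `H` is a `k`-edge-colorable subgraph of `G`. -/
def colorableSizes {V : Type*} (k : ℕ) (G : SimpleGraph V) : Set ℕ :=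
  {m | ∃ H : G.Subgraph, KEdgeColorable H k ∧ H.edgeSet.ncard = m}

/-- `ν_k(G)`, the maximum number of edges of a `k`-edge-colorable subgraph of `G`. -/
noncomputable def nu {V : Type*} (k : ℕ) (G : SimpleGraph V) : ℕ :=
  sSup (colorableSizes k G)

/-- In a finite graph the supremum defining `ν_k(G)` is a maximum. -/
theorem nu_isGreatest {V : Type*} [Finite V] (k : ℕ) (G : SimpleGraph V) :
    IsGreatest (colorableSizes k G) (nu k G) := by
  have hne : (colorableSizes k G).Nonempty := by
    refine ⟨_, ⊥, ⟨fun e => ?_, fun e => ?_⟩, rfl⟩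
    · exact absurd e.2 (by simp)
    · exact absurd e.2 (by simp)
  have hbdd : BddAbove (colorableSizes k G) := by
    refine ⟨G.edgeSet.ncard, ?_⟩
    rintro m ⟨H, -, rfl⟩
    exact Set.ncard_le_ncard H.edgeSet_subset (Set.toFinite _)
  exact ⟨Nat.sSup_mem hne hbdd, fun m hm => le_csSup hbdd hm⟩

/-- A finite bipartite simple graph, with vertices labelled `0, …, n - 1`.
No bipartition is part of the data. -/
structure BipartiteGraph where
  n : ℕ
  graph : SimpleGraph (Fin n)
  bipartite : graph.IsBipartite

open scoped Classical in
/-- The adjacency matrix written row by row; each row is a word of `n` bits followed by the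
end-of-row marker `none`. -/
noncomputable def encodeGraph {n : ℕ} (G : SimpleGraph (Fin n)) : List (Option Bool) :=
  (List.finRange n).flatMap fun i =>
    ((List.finRange n).map fun j => some (decide (G.Adj i j))) ++ [none]

/-- The input word for a pair `(G, k)`: the adjacency matrix of `G`, followed by the binary
representation of `k`, written with a separate copy of the bits. -/
noncomputable def encodeInput (x : BipartiteGraph × ℕ) : List (Option Bool ⊕ Bool) :=
  (encodeGraph x.1.graph).map Sum.inl ++ (Computability.encodeNat x.2).map Sum.inr

theorem encodeGraph_count_none {n : ℕ} (G : SimpleGraph (Fin n)) :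
    (encodeGraph G).countP Option.isNone = n := by
  simp [encodeGraph, List.countP_flatMap, Function.comp_def, List.countP_map]

theorem encodeGraph_injective {n : ℕ} :
    Function.Injective (encodeGraph : SimpleGraph (Fin n) → List (Option Bool)) := by
  classical
  intro G H h
  have key : ∀ (l : List (Fin n)) (f g : Fin n → List (Option Bool)),
      (∀ i, (f i).length = (g i).length) → l.flatMap f = l.flatMap g → ∀ i ∈ l, f i = g i := by
    intro l f g hl
    induction l with
    | nil => simp
    | cons a l ih =>
      intro hh
      rw [List.flatMap_cons, List.flatMap_cons] at hh
      obtain ⟨h1, h2⟩ := List.append_inj hh (hl a)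
      intro i hi
      rcases List.mem_cons.1 hi with rfl | hi
      · exact h1
      · exact ih h2 i hi
  ext i j
  have h1 := key _ _ _ (fun i => by simp) h i (List.mem_finRange i)
  have h2 := List.map_inj_left.1 (List.append_cancel_right h1) j (List.mem_finRange j)
  simpa using h2

/-- Different instances have different input words. -/
theorem encodeInput_injective : Function.Injective encodeInput := by
  rintro ⟨⟨n, G, hG⟩, k⟩ ⟨⟨m, H, hH⟩, l⟩ h
  have h1 := congrArg (List.filterMap Sum.getLeft?) h
  have h2 := congrArg (List.filterMap Sum.getRight?) h
  simp only [encodeInput, List.filterMap_append, List.filterMap_map, Function.comp_def,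
    Sum.getLeft?_inl, Sum.getLeft?_inr, Sum.getRight?_inl, Sum.getRight?_inr,
    List.filterMap_some, List.filterMap_none, List.append_nil, List.nil_append] at h1 h2
  have hk : k = l := by
    have := congrArg Computability.decodeNat h2
    simpa using this
  have hn : n = m := by
    rw [← encodeGraph_count_none G, h1, encodeGraph_count_none H]
  subst hn
  have hg : G = H := encodeGraph_injective h1
  subst hg hk
  rfl

/-- A function is computable in polynomial time, with respect to the given encodings of inputs and
outputs, if a deterministic multi-stack Turing machine with finite alphabets computes it within a
number of steps bounded by a polynomial in the length of the encoded input. -/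
def PolyTimeComputable {α β A B : Type} (encα : α → List A) (encβ : β → List B) (f : α → β) :
    Prop :=
  ∃ M : Turing.TM2ComputableInPolyTime encα encβ f, ∀ s : M.tm.K, Finite (M.tm.Γ s)

/-! ### Kőnig's edge coloring theorem in matrix form. -/

section Konig

open Finset

variable {ι : Type*} [Fintype ι] [DecidableEq ι]

/-! By Kőnig's theorem, a subgraph of a bipartite graph is `k`-edge-colorable exactly when all its
degrees are at most `k`, so `ν_k(G)` is the maximum size of a degree-constrained subgraph. Kőnig's
theorem itself comes from padding a 0-1 matrix to one with constant line sums and peeling off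
permutations by Hall's theorem.

No bipartition has to be found. One maximizes the number of ones of a 0-1 matrix below the adjacency
matrix with all row and column sums at most `k`; rows and columns are two copies of the vertex set.
Both orientations of the edges of an optimal subgraph give `2 ν_k(G)` ones. Conversely, the ones in
the rows of either colour class form a degree-constrained edge set of `G`, so there are at most `2
ν_k(G)` (`card_eq_two_mul_nu`).

The maximum is found by augmenting paths. Everything is stored in row labels, column labels and
matrix cells, so that the algorithm consists of sweeps over the matrix with a purely local update,
which suits stacks. Unused capacity is kept in unary in the cells; this fits because `k` may be
replaced by `min k n`. A search forest grows from rows with spare capacity; when it meets a column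
with spare capacity, the path is traced back and flipped. The invariant `Inv` holds after each sweep
from the end of initialisation on, and `potential`, polynomially bounded, falls with each of these
sweeps (`inv_sweep`). When no label can be added, the labels are a dual solution proving optimality
(`card_le_of_closed`).

The machine counts the ones in binary and drops the lowest bit, which turns `2 ν_k(G)` into
`ν_k(G)`. The bound on its steps is the sum of the bounds for its loops (`within_nu`). -/

/-- A nonnegative integer matrix whose row and column sums all equal `k > 0` has a positive
transversal. -/
theorem exists_perm_forall_pos {k : ℕ} (hk : 0 < k) (M : ι → ι → ℕ)
    (hr : ∀ i, ∑ j, M i j = k) (hc : ∀ j, ∑ i, M i j = k) :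
    ∃ σ : Equiv.Perm ι, ∀ i, 0 < M i (σ i) := by
  have hall := (Finset.all_card_le_biUnion_card_iff_exists_injective
    (fun i => univ.filter fun j => 0 < M i j)).1 (by
      intro s
      set N := s.biUnion fun i => univ.filter fun j => 0 < M i j
      -- Hall's condition by double counting: the rows in `s` carry mass `s.card * k`, all of it
      -- inside the columns `N`, which have room for only `N.card * k`.
      have h1 : ∑ i ∈ s, ∑ j ∈ N, M i j = s.card * k := by
        rw [← smul_eq_mul, ← Finset.sum_const]
        refine Finset.sum_congr rfl fun i hi => ?_
        rw [← hr i]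
        refine Finset.sum_subset (Finset.subset_univ _) fun j _ hj => ?_
        by_contra h
        exact hj (Finset.mem_biUnion.2 ⟨i, hi, by simpa using Nat.pos_of_ne_zero h⟩)
      have h2 : ∑ i ∈ s, ∑ j ∈ N, M i j ≤ N.card * k := by
        rw [Finset.sum_comm, ← smul_eq_mul, ← Finset.sum_const]
        refine Finset.sum_le_sum fun j _ => ?_
        rw [← hc j]
        exact Finset.sum_le_sum_of_subset (Finset.subset_univ _)
      exact Nat.le_of_mul_le_mul_right (h1 ▸ h2) hk)
  obtain ⟨f, hf, hp⟩ := hall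
  exact ⟨Equiv.ofBijective f (Finite.injective_iff_bijective.1 hf), fun i => by simpa using hp i⟩

/-- The support of a nonnegative integer matrix with all row and column sums equal to `k` is
covered by `k` permutations. -/
theorem exists_perms_cover (k : ℕ) (M : ι → ι → ℕ)
    (hr : ∀ i, ∑ j, M i j = k) (hc : ∀ j, ∑ i, M i j = k) :
    ∃ σ : Fin k → Equiv.Perm ι, ∀ i j, 0 < M i j → ∃ c, σ c i = j := by
  induction k generalizing M with
  | zero =>
    refine ⟨Fin.elim0, fun i j h => ?_⟩
    have := Finset.sum_eq_zero_iff.1 (hr i) j (mem_univ j)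
    omega
  | succ k ih =>
    obtain ⟨τ, hτ⟩ := exists_perm_forall_pos k.succ_pos M hr hc
    -- Subtracting the permutation matrix of `τ` lowers all line sums by one; an entry not on `τ`
    -- stays positive.
    have key : ∀ i j, M i j = (M i j - if τ i = j then 1 else 0) + if τ i = j then 1 else 0 := by
      intro i j
      split_ifs with h
      · have := hτ i
        rw [h] at this
        omega
      · simp
    obtain ⟨σ, hσ⟩ := ih (fun i j => M i j - if τ i = j then 1 else 0)
      (fun i => by
        have := hr i
        rw [Finset.sum_congr rfl fun j _ => key i j, Finset.sum_add_distrib] at this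
        simpa using this)
      (fun j => by
        have := hc j
        rw [Finset.sum_congr rfl fun i _ => key i j, Finset.sum_add_distrib] at this
        have h1 : ∑ i, (if τ i = j then 1 else 0) = 1 := by
          simp [← Equiv.eq_symm_apply]
        omega)
    refine ⟨Fin.cons τ σ, fun i j h => ?_⟩
    by_cases hij : τ i = j
    · exact ⟨0, by simpa using hij⟩
    · obtain ⟨c, hc⟩ := hσ i j (by simpa [hij] using h)
      exact ⟨c.succ, by simpa using hc⟩

/-- **Kőnig's edge coloring theorem**, matrix form: the support of a nonnegative integer matrix with
row and column sums at most `k` is covered by `k` partial permutations. -/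
theorem exists_partial_perms_cover {k : ℕ} (X : ι → ι → ℕ)
    (hr : ∀ i, ∑ j, X i j ≤ k) (hc : ∀ j, ∑ i, X i j ≤ k) :
    ∃ σ : Fin k → Equiv.Perm (ι ⊕ ι), ∀ i j, 0 < X i j → ∃ c, σ c (.inl i) = .inl j := by
  -- Pad `X` to a block matrix with `X` and its transpose on the diagonal, and the row and column
  -- deficits as diagonal matrices off it; then all line sums equal `k`.
  obtain ⟨σ, hσ⟩ := exists_perms_cover k
    (fun (u v : ι ⊕ ι) => match u, v with
      | .inl i, .inl j => X i j
      | .inl i, .inr j => if i = j then k - ∑ l, X i l else 0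
      | .inr j, .inl i => if i = j then k - ∑ l, X l j else 0
      | .inr j, .inr i => X i j)
    (by
      rintro (i | j)
      · have := hr i
        simp only [Fintype.sum_sum_type, Finset.sum_ite_eq, mem_univ, if_true]
        omega
      · have := hc j
        simp only [Fintype.sum_sum_type, Finset.sum_ite_eq', mem_univ, if_true]
        omega)
    (by
      rintro (i | j)
      · have := hc i
        simp only [Fintype.sum_sum_type, Finset.sum_ite_eq, mem_univ, if_true]
        omega
      · have := hr j
        simp only [Fintype.sum_sum_type, Finset.sum_ite_eq', mem_univ, if_true]
        omega)
  exact ⟨σ, fun i j h => hσ (.inl i) (.inl j) h⟩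

end Konig

/-! ### From edge colorings to 0-1 matrices with bounded line sums. -/

section DegreeConstrained

open Finset

variable {V : Type*} [Fintype V] [DecidableEq V]

/-- In a bipartite graph with colour class `S`, a set of edges with at most `k` edges at every
vertex has at most `ν_k(G)` elements. -/
theorem card_le_nu {k : ℕ} (G : SimpleGraph V) (S : Set V) (P : V → V → Prop) [DecidableRel P]
    (hP : ∀ u w, P u w → G.Adj u w ∧ u ∈ S ∧ w ∉ S)
    (hr : ∀ u, #{w | P u w} ≤ k) (hc : ∀ w, #{u | P u w} ≤ k) :
    #{p : V × V | P p.1 p.2} ≤ nu k G := by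
  classical
  obtain ⟨σ, hσ⟩ := exists_partial_perms_cover (k := k) (fun u w => if P u w then 1 else 0)
    (fun u => by simpa only [Finset.card_filter] using hr u)
    (fun w => by simpa only [Finset.card_filter] using hc w)
  let H : G.Subgraph :=
    { verts := Set.univ
      Adj := fun u w => P u w ∨ P w u
      adj_sub := by
        rintro u w (h | h)
        · exact (hP _ _ h).1
        · exact (hP _ _ h).1.symm
      edge_vert := fun _ => Set.mem_univ _
      symm := ⟨fun u w h => h.symm⟩ }
  have hrep : ∀ e : H.edgeSet, ∃ u w, (e : Sym2 V) = s(u, w) ∧ P u w := by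
    rintro ⟨e, he⟩
    induction e with
    | _ u w =>
      rcases (SimpleGraph.Subgraph.mem_edgeSet.1 he : P u w ∨ P w u) with h | h
      · exact ⟨u, w, rfl, h⟩
      · exact ⟨w, u, Sym2.eq_swap, h⟩
  choose a b hab hPab using hrep
  -- The permutations serve as colors. Edges run from `S` to its complement, so a common vertex is a
  -- common first or a common second endpoint; one permutation then forces the edges to coincide.
  have hcol : ∀ e : H.edgeSet, ∃ c, σ c (.inl (a e)) = .inl (b e) := fun e =>
    hσ _ _ (by simp [hPab e])
  choose c hc using hcol
  refine (nu_isGreatest k G).2 ⟨H, ⟨c, ?_⟩, ?_⟩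
  · rintro e f hef ⟨v, hve, hvf⟩ hcc
    apply hef
    rw [hab e, Sym2.mem_iff] at hve
    rw [hab f, Sym2.mem_iff] at hvf
    have he := hc e
    have hf := hc f
    have h1 := (hP _ _ (hPab e)).2
    have h2 := (hP _ _ (hPab f)).2
    rw [hcc] at he
    have key : a e = a f ∧ b e = b f := by
      rcases hve with hve | hve <;> rcases hvf with hvf | hvf
      · have h3 : a e = a f := hve.symm.trans hvf
        rw [h3, hf] at he
        exact ⟨h3, (Sum.inl.inj he).symm⟩
      · exact absurd h1.1 (by rw [← hve, hvf]; exact h2.2)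
      · exact absurd h2.1 (by rw [← hvf, hve]; exact h1.2)
      · have h3 : b e = b f := hve.symm.trans hvf
        rw [h3, ← hf] at he
        exact ⟨Sum.inl.inj ((σ _).injective he), h3⟩
    exact Subtype.ext (by rw [hab e, hab f, key.1, key.2])
  · have himg : H.edgeSet = (({p : V × V | P p.1 p.2} : Finset (V × V)).image
        fun p => s(p.1, p.2) : Finset (Sym2 V)) := by
      ext e
      constructor
      · intro he
        rw [Finset.mem_coe, Finset.mem_image]
        exact ⟨(a ⟨e, he⟩, b ⟨e, he⟩), by simpa using hPab ⟨e, he⟩, (hab ⟨e, he⟩).symm⟩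
      · intro he
        rw [Finset.mem_coe, Finset.mem_image] at he
        obtain ⟨p, hp, rfl⟩ := he
        exact SimpleGraph.Subgraph.mem_edgeSet.2 (Or.inl (by simpa using hp))
    rw [himg, Set.ncard_coe_finset]
    refine Finset.card_image_of_injOn ?_
    rintro ⟨u, w⟩ hp ⟨u', w'⟩ hp' he
    simp only [Finset.coe_filter, Finset.mem_univ, true_and, Set.mem_ofPred_eq] at hp hp'
    rcases Sym2.eq_iff.1 he with ⟨h1, h2⟩ | ⟨h1, h2⟩
    · exact Prod.ext h1 h2
    · simp only at h1 h2
      exact absurd (hP _ _ hp).2.1 (by rw [h1]; exact (hP _ _ hp').2.2)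

/-- The arcs of a maximum `k`-edge-colorable subgraph form a relation with at most `k` arcs leaving
and entering every vertex. -/
theorem exists_rel_card_eq_two_mul_nu (k : ℕ) (G : SimpleGraph V) :
    ∃ X : V → V → Bool, (∀ u w, X u w → G.Adj u w) ∧ (∀ u, #{w | X u w} ≤ k) ∧
      (∀ w, #{u | X u w} ≤ k) ∧ #{p : V × V | X p.1 p.2} = 2 * nu k G := by
  classical
  obtain ⟨H, ⟨c, hc⟩, hH⟩ := (nu_isGreatest k G).1
  -- The edges at `u` have distinct colors.
  have hrow : ∀ u, #{w | H.Adj u w} ≤ k := by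
    intro u
    have := Fintype.card_le_of_injective
      (fun w : {w // w ∈ ({w | H.Adj u w} : Finset V)} =>
        c ⟨s(u, w.1), SimpleGraph.Subgraph.mem_edgeSet.2 (Finset.mem_filter.1 w.2).2⟩)
      (by
        intro w w' h
        by_contra hne
        refine hc _ _ ?_ ⟨u, ?_, ?_⟩ h
        · intro h'
          apply hne
          have h'' := congrArg Subtype.val h'
          simp only [Sym2.eq_iff, true_and] at h''
          rcases h'' with h'' | ⟨h1, h2⟩
          · exact Subtype.ext h''
          · exact Subtype.ext (h2.trans h1)
        · exact Sym2.mem_mk_left _ _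
        · exact Sym2.mem_mk_left _ _)
    rwa [Fintype.card_coe, Fintype.card_fin] at this
  refine ⟨fun u w => decide (H.Adj u w), fun u w h => H.adj_sub (by simpa using h),
    fun u => by simpa using hrow u, fun w => ?_, ?_⟩
  · simpa [H.adj_comm] using hrow w
  · have h1 := H.spanningCoe.sum_degrees_eq_twice_card_edges
    have h2 : #H.spanningCoe.edgeFinset = nu k G := by
      rw [← hH, ← Set.ncard_coe_finset, SimpleGraph.coe_edgeFinset]
      congr 1
    rw [← h2, ← h1, Finset.card_filter, Fintype.sum_prod_type]
    refine Finset.sum_congr rfl fun u _ => ?_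
    rw [← SimpleGraph.card_neighborFinset_eq_degree, ← Finset.card_filter]
    congr 1
    ext w
    simp

/-- For bipartite `G`, the largest 0-1 matrix below the adjacency matrix with row and column sums at
most `k` has exactly `2 ν_k(G)` ones. -/
theorem card_eq_two_mul_nu {k : ℕ} (G : SimpleGraph V) (hG : G.IsBipartite)
    (X : V → V → Bool) (hA : ∀ u w, X u w → G.Adj u w)
    (hr : ∀ u, #{w | X u w} ≤ k) (hc : ∀ w, #{u | X u w} ≤ k)
    (hmax : ∀ X' : V → V → Bool, (∀ u w, X' u w → G.Adj u w) → (∀ u, #{w | X' u w} ≤ k) →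
      (∀ w, #{u | X' u w} ≤ k) → #{p : V × V | X' p.1 p.2} ≤ #{p : V × V | X p.1 p.2}) :
    #{p : V × V | X p.1 p.2} = 2 * nu k G := by
  refine le_antisymm ?_ ?_
  · obtain ⟨f⟩ := hG
    -- The ones in rows of colour `a` are arcs leaving one colour class, so distinct ones are
    -- distinct edges.
    have hside : ∀ a : Fin 2, #{p : V × V | X p.1 p.2 ∧ f p.1 = a} ≤ nu k G := by
      intro a
      refine card_le_nu G {v | f v = a} (fun u w => X u w ∧ f u = a) ?_ ?_ ?_
      · rintro u w ⟨h1, h2⟩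
        refine ⟨hA _ _ h1, h2, fun h3 => f.valid (hA _ _ h1) (h2.trans h3.symm)⟩
      · exact fun u => (Finset.card_le_card fun w => by simp +contextual).trans (hr u)
      · exact fun w => (Finset.card_le_card fun w => by simp +contextual).trans (hc w)
    have h0 := hside 0
    have h1 := hside 1
    have : ({p : V × V | X p.1 p.2} : Finset (V × V)) ⊆
        ({p : V × V | X p.1 p.2 ∧ f p.1 = 0} : Finset _) ∪
          ({p : V × V | X p.1 p.2 ∧ f p.1 = 1} : Finset _) := by
      intro p hp
      have : f p.1 = 0 ∨ f p.1 = 1 := by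
        generalize f p.1 = a
        revert a
        decide
      simp only [Finset.mem_filter, Finset.mem_union, Finset.mem_univ, true_and] at hp ⊢
      tauto
    have := (Finset.card_le_card this).trans (Finset.card_union_le _ _)
    omega
  · obtain ⟨X', h1, h2, h3, h4⟩ := exists_rel_card_eq_two_mul_nu k G
    exact h4 ▸ hmax X' h1 h2 h3

end DegreeConstrained

/-! ### The augmenting path algorithm as a sequence of local updates. -/

section Algorithm

/-- Labels of rows and columns. During initialisation `full` marks the first slots; later a vertex
is `fresh`, `reached` by the search, or the `active` end of the path being augmented. -/
inductive VertexMark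
  | full | fresh | reached | active
  deriving DecidableEq

instance : Fintype VertexMark where
  elems := {.full, .fresh, .reached, .active}
  complete x := by cases x <;> decide

/-- An entry of the working matrix: adjacency bit `a`, membership `x` in the current subgraph,
unused capacity `y` of the row, unused capacity `z` of the column, and the search-tree bit `p`. -/
structure Cell where
  a : Bool
  x : Bool
  y : Bool
  z : Bool
  p : Bool
  deriving DecidableEq, Fintype

/-- The phases of the computation. In `mark b`, the bit `b` tells whether something has changed
during the current sweep. -/
inductive Phase
  | start | init | clear | mark (b : Bool) | trace | fin | done
  deriving DecidableEq, Fintype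

open VertexMark Phase

/-- The update performed when visiting an entry, given its row label and column label. -/
def localStep (q : Phase) (r c : VertexMark) (m : Cell) : Phase × VertexMark × VertexMark × Cell :=
  match q with
  -- Equally many rows and columns are labelled `full`, so every row receives that many `y` slots
  -- and every column that many `z` slots.
  | init => (init, r, c, { m with y := c = full, z := r = full })
  | clear => (clear, fresh, fresh, { m with p := false })
  -- Alternating search: rows with a free slot are roots, absent edges are followed from row to
  -- column, present ones from column to row. A reached column with a free slot spends it and
  -- becomes the active end.
  | mark b =>
    if m.y ∧ r = fresh then (mark true, reached, c, m)
    else if r = reached ∧ m.a ∧ m.x = false ∧ c = fresh then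
      (mark true, r, reached, { m with p := true })
    else if c = reached ∧ m.x ∧ r = fresh then (mark true, reached, c, { m with p := true })
    else if c = reached ∧ m.z then (trace, r, active, { m with z := false })
    else (mark b, r, c, m)
  -- Walk back along parent bits, flipping `x`. An active column is one unit short, an active row
  -- one unit over; a row with a free slot absorbs the unit and ends the walk.
  | trace =>
    if c = active ∧ m.p ∧ m.x = false then
      (trace, active, reached, { m with x := true, p := false })
    else if r = active ∧ m.y then (fin, reached, c, { m with y := false })
    else if r = active ∧ m.p ∧ m.x then
      (trace, reached, active, { m with x := false, p := false })
    else (trace, r, c, m)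
  | q => (q, r, c, m)

/-- The change of phase at the end of a sweep. -/
def Phase.next : Phase → Phase
  | start => init
  | init => clear
  | clear => mark false
  | mark true => mark false
  -- The bit is still `false` only if the sweep changed nothing, so the search is complete.
  | mark false => done
  | trace => trace
  | fin => clear
  | done => done

/-- The state of the augmenting path algorithm on an `n × n` matrix. -/
@[ext]
structure SweepState (n : ℕ) where
  ph : Phase
  r : Fin n → VertexMark
  c : Fin n → VertexMark
  m : Fin n → Fin n → Cell

namespace SweepState

variable {n : ℕ}

/-- Replace the phase, and the data belonging to the entry `(i, j)`. -/
def set (st : SweepState n) (i j : Fin n) (o : Phase × VertexMark × VertexMark × Cell) :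
    SweepState n where
  ph := o.1
  r := Function.update st.r i o.2.1
  c := Function.update st.c j o.2.2.1
  m := Function.update st.m i (Function.update (st.m i) j o.2.2.2)

/-- Visit the entry `(i, j)`. -/
def step (st : SweepState n) (i j : Fin n) : SweepState n :=
  st.set i j (localStep st.ph (st.r i) (st.c j) (st.m i j))

/-- Visit the entries of row `i` at the columns in `l`. -/
def sweepRow (st : SweepState n) (i : Fin n) (l : List (Fin n)) : SweepState n :=
  l.foldl (fun s j => s.step i j) st

/-- Visit all entries of the rows in `l`. -/
def sweepRows (st : SweepState n) (l : List (Fin n)) : SweepState n :=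
  l.foldl (fun s i => s.sweepRow i (List.finRange n)) st

/-- Adjust the phase at the end of a sweep. -/
def endSweep (st : SweepState n) : SweepState n := { st with ph := st.ph.next }

/-- A complete sweep. -/
def sweep (st : SweepState n) : SweepState n := (st.sweepRows (List.finRange n)).endSweep

/-- Turns the nested loops into one fold over pairs, to which the general fold lemmas apply. -/
theorem sweepRows_eq (st : SweepState n) (l : List (Fin n)) :
    st.sweepRows l = (l.flatMap fun i => (List.finRange n).map fun j => (i, j)).foldl
      (fun s p => s.step p.1 p.2) st := by
  induction l generalizing st with
  | nil => rfl
  | cons i l ih =>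
    rw [List.flatMap_cons, List.foldl_append, List.foldl_map, ← ih]
    rfl

@[simp] theorem set_ph (st : SweepState n) (i j o) : (st.set i j o).ph = o.1 := rfl

theorem set_r (st : SweepState n) (i j o i') :
    (st.set i j o).r i' = if i' = i then o.2.1 else st.r i' := by
  simp [set, Function.update_apply]

theorem set_c (st : SweepState n) (i j o j') :
    (st.set i j o).c j' = if j' = j then o.2.2.1 else st.c j' := by
  simp [set, Function.update_apply]

theorem set_m (st : SweepState n) (i j o i' j') :
    (st.set i j o).m i' j' = if i' = i ∧ j' = j then o.2.2.2 else st.m i' j' := by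
  by_cases h : i' = i
  · subst h
    simp [set, Function.update_apply]
  · simp [set, h]

theorem set_self (st : SweepState n) (i j : Fin n) :
    st.set i j (st.ph, st.r i, st.c j, st.m i j) = st := by
  simp [set]

theorem localStep_eq_of_step_eq {st : SweepState n} {i j : Fin n} (h : st.step i j = st) :
    localStep st.ph (st.r i) (st.c j) (st.m i j) = (st.ph, st.r i, st.c j, st.m i j) := by
  unfold step at h
  generalize localStep st.ph (st.r i) (st.c j) (st.m i j) = o at h
  have h1 := congrArg SweepState.ph h
  have h2 := congrFun (congrArg SweepState.r h) i
  have h3 := congrFun (congrArg SweepState.c h) j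
  have h4 := congrFun (congrFun (congrArg SweepState.m h) i) j
  rw [set_ph] at h1
  rw [set_r, if_pos rfl] at h2
  rw [set_c, if_pos rfl] at h3
  rw [set_m, if_pos ⟨rfl, rfl⟩] at h4
  rw [← h1, ← h2, ← h3, ← h4]

section Fold

variable {α : Type*} {f : SweepState n → α → SweepState n} {P : SweepState n → Prop}

theorem foldl_invariant (hP : ∀ s a, P s → P (f s a)) (l : List α) {s : SweepState n} (hs : P s) :
    P (l.foldl f s) := by
  induction l generalizing s with
  | nil => exact hs
  | cons a l ih => exact ih (hP s a hs)

/-- If each step is idle or lowers `μ`, a fold that fails to lower `μ` was idle throughout. For a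
sweep this means: either progress, or a state fixed by every local update. -/
theorem foldl_fixed_or_lt (μ : SweepState n → ℕ) (hP : ∀ s a, P s → P (f s a))
    (hμ : ∀ s a, P s → f s a = s ∨ μ (f s a) < μ s) (l : List α) {s : SweepState n} (hs : P s) :
    (l.foldl f s = s ∧ ∀ a ∈ l, f s a = s) ∨ μ (l.foldl f s) < μ s := by
  induction l generalizing s with
  | nil => exact Or.inl ⟨rfl, by simp⟩
  | cons a l ih =>
    rw [List.foldl_cons]
    rcases hμ s a hs with h | h
    · rw [h]
      refine (ih hs).imp (fun h' => ⟨h'.1, ?_⟩) id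
      rintro b hb
      rcases List.mem_cons.1 hb with rfl | hb
      · exact h
      · exact h'.2 b hb
    · refine Or.inr ?_
      rcases ih (hP s a hs) with h' | h'
      · rwa [h'.1]
      · exact h'.trans h

/-- The property of `a` is created when `a` is visited and survives all later visits. -/
theorem foldl_establish {Q : α → SweepState n → Prop} (hP : ∀ s a, P s → P (f s a))
    (hQ : ∀ s a, P s → Q a (f s a)) (hQ' : ∀ s a b, P s → Q b s → Q b (f s a))
    (l : List α) {s : SweepState n} (hs : P s) : ∀ a ∈ l, Q a (l.foldl f s) := by
  have key : ∀ (l : List α) (s : SweepState n) (b : α), P s → Q b s → Q b (l.foldl f s) := by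
    intro l
    induction l with
    | nil => exact fun s b _ h => h
    | cons a l ih => exact fun s b hs h => ih _ b (hP s a hs) (hQ' s a b hs h)
  induction l generalizing s with
  | nil => simp
  | cons a l ih =>
    intro b hb
    rcases List.mem_cons.1 hb with rfl | hb
    · exact key l _ b (hP s b hs) (hQ s b hs)
    · exact ih (hP s a hs) b hb

end Fold

/-- Sum of a weight over all entries. -/
def total (w : Cell → ℕ) (st : SweepState n) : ℕ := ∑ i, ∑ j, w (st.m i j)

/-- Kept in additive form to avoid truncated subtraction; the sums over rows, columns and the whole
matrix follow this pattern. -/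
theorem sum_update {β : Type*} (w : β → ℕ) (f : Fin n → β) (i : Fin n) (b : β) :
    ∑ i', w (Function.update f i b i') + w (f i) = ∑ i', w (f i') + w b := by
  rw [← Finset.add_sum_erase _ _ (Finset.mem_univ i),
    ← Finset.add_sum_erase Finset.univ (fun i' => w (f i')) (Finset.mem_univ i),
    Function.update_self]
  rw [Finset.sum_congr rfl fun i' hi' => by
    rw [Function.update_of_ne (Finset.ne_of_mem_erase hi')]]
  ring

theorem sum_row_set (w : Cell → ℕ) (st : SweepState n) (i j : Fin n) (o) :
    ∑ j', w ((st.set i j o).m i j') + w (st.m i j) = ∑ j', w (st.m i j') + w o.2.2.2 := by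
  simp only [set, Function.update_self]
  exact sum_update w (st.m i) j o.2.2.2

theorem sum_row_set_of_ne (w : Cell → ℕ) (st : SweepState n) {i i' : Fin n} (j : Fin n) (o)
    (h : i' ≠ i) : ∑ j', w ((st.set i j o).m i' j') = ∑ j', w (st.m i' j') := by
  simp [set, Function.update_of_ne h]

theorem sum_col_set (w : Cell → ℕ) (st : SweepState n) (i j : Fin n) (o) :
    ∑ i', w ((st.set i j o).m i' j) + w (st.m i j) = ∑ i', w (st.m i' j) + w o.2.2.2 := by
  rw [← sum_update w (fun i' => st.m i' j) i o.2.2.2]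
  congr 1
  refine Finset.sum_congr rfl fun i' _ => ?_
  rw [set_m, Function.update_apply]
  simp

theorem sum_col_set_of_ne (w : Cell → ℕ) (st : SweepState n) (i : Fin n) {j j' : Fin n} (o)
    (h : j' ≠ j) : ∑ i', w ((st.set i j o).m i' j') = ∑ i', w (st.m i' j') := by
  simp [set_m, h]

theorem total_set (w : Cell → ℕ) (st : SweepState n) (i j : Fin n) (o) :
    total w (st.set i j o) + w (st.m i j) = total w st + w o.2.2.2 := by
  have h1 := sum_row_set w st i j o
  have h2 : ∑ i' ∈ Finset.univ.erase i, ∑ j', w ((st.set i j o).m i' j') =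
      ∑ i' ∈ Finset.univ.erase i, ∑ j', w (st.m i' j') :=
    Finset.sum_congr rfl fun i' hi' => sum_row_set_of_ne w st j o (Finset.ne_of_mem_erase hi')
  unfold total
  rw [← Finset.add_sum_erase _ _ (Finset.mem_univ i),
    ← Finset.add_sum_erase Finset.univ (fun i' => ∑ j', w (st.m i' j')) (Finset.mem_univ i), h2]
  omega

end SweepState

end Algorithm

/-! ### The invariant and its preservation by a single visit. -/

section Algorithm

open VertexMark Phase

namespace SweepState

variable {n : ℕ}

theorem step_mark {st : SweepState n} {b : Bool} (hb : st.ph = mark b) (i j : Fin n) :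
    st.step i j = st ∨
    ((st.m i j).y = true ∧ st.r i = fresh ∧
      st.step i j = st.set i j (mark true, reached, st.c j, st.m i j)) ∨
    (st.r i = reached ∧ (st.m i j).a = true ∧ (st.m i j).x = false ∧ st.c j = fresh ∧
      st.step i j = st.set i j (mark true, reached, reached, { st.m i j with p := true })) ∨
    (st.c j = reached ∧ (st.m i j).x = true ∧ st.r i = fresh ∧
      st.step i j = st.set i j (mark true, reached, reached, { st.m i j with p := true })) ∨
    (st.c j = reached ∧ (st.m i j).z = true ∧
      st.step i j = st.set i j (trace, st.r i, active, { st.m i j with z := false })) := by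
  unfold step
  rw [hb]
  simp only [localStep]
  split_ifs with h1 h2 h3 h4
  · exact Or.inr (Or.inl ⟨h1.1, h1.2, rfl⟩)
  · exact Or.inr (Or.inr (Or.inl ⟨h2.1, h2.2.1, h2.2.2.1, h2.2.2.2, by rw [h2.1]⟩))
  · exact Or.inr (Or.inr (Or.inr (Or.inl ⟨h3.1, h3.2.1, h3.2.2, by rw [h3.1]⟩)))
  · exact Or.inr (Or.inr (Or.inr (Or.inr ⟨h4.1, h4.2, rfl⟩)))
  · left
    rw [← hb]
    exact st.set_self i j

theorem step_trace {st : SweepState n} (hb : st.ph = trace) (i j : Fin n) :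
    st.step i j = st ∨
    (st.c j = active ∧ (st.m i j).p = true ∧ (st.m i j).x = false ∧
      st.step i j = st.set i j (trace, active, reached, { st.m i j with x := true, p := false })) ∨
    (st.r i = active ∧ (st.m i j).y = true ∧
      st.step i j = st.set i j (fin, reached, st.c j, { st.m i j with y := false })) ∨
    (st.r i = active ∧ (st.m i j).p = true ∧ (st.m i j).x = true ∧
      st.step i j =
        st.set i j (trace, reached, active, { st.m i j with x := false, p := false })) := by
  unfold step
  rw [hb]
  simp only [localStep]
  split_ifs with h1 h2 h3
  · exact Or.inr (Or.inl ⟨h1.1, h1.2.1, h1.2.2, rfl⟩)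
  · exact Or.inr (Or.inr (Or.inl ⟨h2.1, h2.2, rfl⟩))
  · exact Or.inr (Or.inr (Or.inr ⟨h3.1, h3.2.1, h3.2.2, rfl⟩))
  · left
    rw [← hb]
    exact st.set_self i j

theorem step_eq_self {st : SweepState n} (h : st.ph = start ∨ st.ph = fin ∨ st.ph = done)
    (i j : Fin n) : st.step i j = st := by
  have := st.set_self i j
  unfold step
  rcases h with h | h | h <;> rw [h] at this ⊢ <;> exact this

/-- The matrix `x` is below the adjacency matrix `A`, and the capacity `k` of every row and column
is accounted for, up to the surplus or deficit at the active vertex. -/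
structure Balanced (A : Fin n → Fin n → Bool) (k : ℕ) (st : SweepState n) : Prop where
  adj : ∀ i j, (st.m i j).a = A i j
  sub : ∀ i j, (st.m i j).x = true → A i j = true
  row : ∀ i, ∑ j, ((st.m i j).x.toNat + (st.m i j).y.toNat) =
    k + if st.r i = active then 1 else 0
  col : ∀ j, ∑ i, ((st.m i j).x.toNat + (st.m i j).z.toNat) +
    (if st.c j = active then 1 else 0) = k

/-- Only row `i` and column `j` are affected, so conservation at the one entry, with the labels'
surplus or deficit included, is enough. -/
theorem Balanced.set {A : Fin n → Fin n → Bool} {k : ℕ} {st : SweepState n}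
    (h : st.Balanced A k) (i j : Fin n) {q : Phase} {r c : VertexMark} {m : Cell}
    (ha : m.a = (st.m i j).a) (hx : m.x = true → A i j = true)
    (hr : m.x.toNat + m.y.toNat + (if st.r i = active then 1 else 0) =
      (st.m i j).x.toNat + (st.m i j).y.toNat + if r = active then 1 else 0)
    (hc : m.x.toNat + m.z.toNat + (if c = active then 1 else 0) =
      (st.m i j).x.toNat + (st.m i j).z.toNat + if st.c j = active then 1 else 0) :
    (st.set i j (q, r, c, m)).Balanced A k where
  adj i' j' := by
    rw [set_m]
    split_ifs with h'
    · rw [h'.1, h'.2, ← h.adj i j, ← ha]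
    · exact h.adj i' j'
  sub i' j' := by
    rw [set_m]
    split_ifs with h'
    · rw [h'.1, h'.2]
      exact hx
    · exact h.sub i' j'
  row i' := by
    rw [set_r]
    by_cases hi : i' = i
    · subst hi
      have h1 := sum_row_set (fun m => m.x.toNat + m.y.toNat) st i' j (q, r, c, m)
      have h2 := h.row i'
      simp only at h1
      rw [if_pos rfl]
      simp only
      omega
    · rw [if_neg hi, ← h.row i']
      exact sum_row_set_of_ne (fun m => m.x.toNat + m.y.toNat) st j (q, r, c, m) hi
  col j' := by
    rw [set_c]
    by_cases hj : j' = j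
    · subst hj
      have h1 := sum_col_set (fun m => m.x.toNat + m.z.toNat) st i j' (q, r, c, m)
      have h2 := h.col j'
      simp only at h1
      rw [if_pos rfl]
      simp only
      omega
    · rw [if_neg hj, ← h.col j']
      congr 1
      exact sum_col_set_of_ne (fun m => m.x.toNat + m.z.toNat) st i (q, r, c, m) hj

/-- The bits `p` form a search forest: along them the rank `ρ` decreases towards the roots, and every
labelled vertex of rank at most `L` has a parent or is a root. -/
structure SearchForest (ρ : Fin n ⊕ Fin n → ℕ) (L : ℕ) (st : SweepState n) : Prop where
  labelled : ∀ i j, (st.m i j).p = true → st.r i ≠ fresh ∧ st.c j ≠ fresh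
  adj : ∀ i j, (st.m i j).p = true → (st.m i j).a = true
  col_gt : ∀ i j, (st.m i j).p = true → (st.m i j).x = false → ρ (.inl i) < ρ (.inr j)
  row_gt : ∀ i j, (st.m i j).p = true → (st.m i j).x = true → ρ (.inr j) < ρ (.inl i)
  row : ∀ i, st.r i ≠ fresh → ρ (.inl i) ≤ L →
    (∃ j, (st.m i j).y = true) ∨ ∃ j, (st.m i j).p = true ∧ (st.m i j).x = true
  col : ∀ j, st.c j ≠ fresh → ρ (.inr j) ≤ L →
    ∃ i, (st.m i j).p = true ∧ (st.m i j).x = false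

/-- The label of a row or column. -/
def status (st : SweepState n) : Fin n ⊕ Fin n → VertexMark := Sum.elim st.r st.c

@[simp] theorem status_inl (st : SweepState n) (i) : st.status (.inl i) = st.r i := rfl

@[simp] theorem status_inr (st : SweepState n) (j) : st.status (.inr j) = st.c j := rfl

/-- A vertex label occurring in a search. -/
def Settled (v : VertexMark) : Prop := v = fresh ∨ v = reached

/-- The search cannot be continued. -/
structure Closed (st : SweepState n) : Prop where
  root : ∀ i j, (st.m i j).y = true → st.r i ≠ fresh
  forward : ∀ i j, st.r i = reached → (st.m i j).a = true → (st.m i j).x = false → st.c j ≠ fresh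
  backward : ∀ i j, st.c j = reached → (st.m i j).x = true → st.r i ≠ fresh
  exit : ∀ i j, st.c j = reached → (st.m i j).z = false

/-- The phase-dependent part of the invariant. -/
def PhaseInv (st : SweepState n) : Prop :=
  match st.ph with
  | mark _ => (∀ u, Settled (st.status u)) ∧ ∃ ρ L, (∀ u, ρ u ≤ L) ∧ st.SearchForest ρ L
  -- Tracing erases the parent bits it has used, so parents are claimed only up to the rank of the
  -- active vertex.
  | trace => ∃ ρ v, st.status v = active ∧ (∀ u, u ≠ v → Settled (st.status u)) ∧
      st.SearchForest ρ (ρ v)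
  | fin => ∀ u, st.status u ≠ active
  | clear => ∀ u, st.status u ≠ active
  | done => (∀ u, Settled (st.status u)) ∧ st.Closed
  | _ => False

/-- The invariant of the algorithm. -/
def Inv (A : Fin n → Fin n → Bool) (k : ℕ) (st : SweepState n) : Prop :=
  st.Balanced A k ∧ st.PhaseInv

theorem Settled.ne_active {v : VertexMark} (h : Settled v) : v ≠ active := by
  rcases h with rfl | rfl <;> decide

theorem set_status (st : SweepState n) (i j o u) :
    (st.set i j o).status u =
      if u = .inl i then o.2.1 else if u = .inr j then o.2.2.1 else st.status u := by
  rcases u with i' | j'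
  · simp [set_r]
  · simp [set_c]

/-- A newly labelled vertex gets rank `L + 1`. No parent bit touches a fresh vertex, so changing its
rank disturbs nothing. At an exit the forest is kept and the spent `z` slot makes the column active.
-/
theorem inv_step_mark {A : Fin n → Fin n → Bool} {k : ℕ} {st : SweepState n} {b : Bool}
    (hb : st.ph = mark b) (h : st.Inv A k) (i j : Fin n) : (st.step i j).Inv A k := by
  obtain ⟨hB, hI⟩ := h
  have hI' := hI
  simp only [PhaseInv, hb] at hI
  obtain ⟨hS, ρ, L, hL, hF⟩ := hI
  have hri : st.r i ≠ active := (hS (.inl i)).ne_active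
  have hcj : st.c j ≠ active := (hS (.inr j)).ne_active
  obtain ⟨hF0, hFa, hF1, hF2, hF3, hF4⟩ := hF
  rcases step_mark hb i j with e | ⟨hy, hr, e⟩ | ⟨hr, ha, hx, hc, e⟩ | ⟨hc, hx, hr, e⟩ |
    ⟨hc, hz, e⟩
  · rw [e]
    exact ⟨hB, hI'⟩
  · rw [e]
    refine ⟨hB.set i j rfl (hB.sub i j) (by simp [hr]) rfl, ?_, Function.update ρ (.inl i) (L + 1),
      L + 1, ?_, ?_⟩
    · intro u
      rw [set_status]
      have := hS (.inr j)
      rw [status_inr] at this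
      grind [Settled]
    · grind [Function.update_apply]
    · constructor <;> simp only [set_r, set_c, set_m, Function.update_apply] <;> grind
  · rw [e]
    refine ⟨hB.set i j rfl (hB.sub i j) (by simp [hr]) (by simp [hc]), ?_,
      Function.update ρ (.inr j) (L + 1), L + 1, ?_, ?_⟩
    · intro u
      rw [set_status]
      grind [Settled]
    · grind [Function.update_apply]
    · constructor <;> simp only [set_r, set_c, set_m, Function.update_apply] <;> grind
  · rw [e]
    refine ⟨hB.set i j rfl (hB.sub i j) (by simp [hr]) (by simp [hc]), ?_,
      Function.update ρ (.inl i) (L + 1), L + 1, ?_, ?_⟩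
    · intro u
      rw [set_status]
      grind [Settled]
    · grind [Function.update_apply]
    · have := hB.adj
      have := hB.sub
      constructor <;> simp only [set_r, set_c, set_m, Function.update_apply] <;> grind
  · rw [e]
    refine ⟨hB.set i j rfl (hB.sub i j) (by simp) (by simp [hc, hz]), ρ, .inr j, ?_, ?_, ?_⟩
    · simp [set_c]
    · intro u hu
      rw [set_status]
      have := hS (.inl i)
      rw [status_inl] at this
      grind [Settled]
    · constructor <;> simp only [set_r, set_c, set_m] <;> grind

/-- Flipping a parent entry hands the imbalance to a vertex of smaller rank. The rank bound sinks
with it, so the erased parent bit is no longer needed. -/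
theorem inv_step_trace {A : Fin n → Fin n → Bool} {k : ℕ} {st : SweepState n}
    (hb : st.ph = trace) (h : st.Inv A k) (i j : Fin n) : (st.step i j).Inv A k := by
  obtain ⟨hB, hI⟩ := h
  have hI' := hI
  simp only [PhaseInv, hb] at hI
  obtain ⟨ρ, v, hv, hS, hF⟩ := hI
  obtain ⟨hF0, hFa, hF1, hF2, hF3, hF4⟩ := hF
  rcases step_trace hb i j with e | ⟨hc, hp, hx, e⟩ | ⟨hr, hy, e⟩ | ⟨hr, hp, hx, e⟩
  · rw [e]
    exact ⟨hB, hI'⟩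
  · have hvj : v = .inr j := by
      by_contra hne
      exact (hS (.inr j) (Ne.symm hne)).ne_active hc
    subst hvj
    have hri : st.r i ≠ active := (hS (.inl i) (by simp)).ne_active
    rw [e]
    refine ⟨hB.set i j rfl (fun _ => ?_) (by simp [hri, hx]; omega) (by simp [hc, hx]; omega), ρ,
      .inl i, ?_, ?_, ?_⟩
    · rw [← hB.adj]
      exact hFa i j hp
    · simp [set_r]
    · intro u hu
      rw [set_status]
      grind [Settled]
    · constructor <;> simp only [set_r, set_c, set_m] <;> grind
  · have hvi : v = .inl i := by
      by_contra hne
      exact (hS (.inl i) (Ne.symm hne)).ne_active hr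
    subst hvi
    rw [e]
    refine ⟨hB.set i j rfl (hB.sub i j) (by simp [hr, hy]) rfl, ?_⟩
    intro u
    rw [set_status]
    have : ∀ u, u ≠ .inl i → st.status u ≠ active := fun u hu => (hS u hu).ne_active
    have := this (.inr j) (by simp)
    grind [status_inr]
  · have hvi : v = .inl i := by
      by_contra hne
      exact (hS (.inl i) (Ne.symm hne)).ne_active hr
    subst hvi
    have hcj : st.c j ≠ active := (hS (.inr j) (by simp)).ne_active
    rw [e]
    refine ⟨hB.set i j rfl (by simp) (by simp [hr, hx]; omega) (by simp [hcj, hx]; omega), ρ,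
      .inr j, ?_, ?_, ?_⟩
    · simp [set_c]
    · intro u hu
      rw [set_status]
      grind [Settled]
    · constructor <;> simp only [set_r, set_c, set_m] <;> grind

end SweepState

end Algorithm

/-! ### Termination: the potential and the effect of a full sweep. -/

section Algorithm

open VertexMark Phase

namespace SweepState

variable {n : ℕ}

/-- The number of vertices without a label. -/
def freshCount (st : SweepState n) : ℕ :=
  ∑ i, (if st.r i = fresh then 1 else 0) + ∑ j, if st.c j = fresh then 1 else 0

/-- A quantity that decreases with every sweep. -/
def potential (st : SweepState n) : ℕ :=
  let Y := st.total fun m => m.y.toNat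
  -- One more than the largest offset below, so that the unit of `Y` lost in an augmentation pays
  -- for the next round of search.
  let W := n * n + 2 * n + 6
  match st.ph with
  | mark _ => Y * W + st.freshCount + n * n + 3
  | trace => Y * W + (st.total fun m => m.p.toNat) + 2
  | fin => Y * W + n * n + 2 * n + 5
  | clear => Y * W + n * n + 2 * n + 4
  | _ => 0

theorem total_le {w : Cell → ℕ} (hw : ∀ m, w m ≤ 1) (st : SweepState n) :
    st.total w ≤ n * n := by
  refine (Finset.sum_le_sum fun i _ => Finset.sum_le_sum fun j _ => hw (st.m i j)).trans ?_
  simp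

theorem freshCount_le (st : SweepState n) : st.freshCount ≤ 2 * n := by
  have key : ∀ f : Fin n → VertexMark, ∑ i, (if f i = fresh then 1 else 0) ≤ n := fun f =>
    (Finset.sum_le_sum fun i _ => show (if f i = fresh then 1 else 0) ≤ 1 by
      split_ifs <;> omega).trans (by simp)
  have h1 := key st.r
  have h2 := key st.c
  unfold freshCount
  omega

theorem freshCount_set (st : SweepState n) (i j o) :
    (st.set i j o).freshCount +
        ((if st.r i = fresh then 1 else 0) + if st.c j = fresh then 1 else 0) =
      st.freshCount + ((if o.2.1 = fresh then 1 else 0) + if o.2.2.1 = fresh then 1 else 0) := by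
  have h1 := sum_update (fun v : VertexMark => if v = fresh then 1 else 0) st.r i o.2.1
  have h2 := sum_update (fun v : VertexMark => if v = fresh then 1 else 0) st.c j o.2.2.1
  dsimp only [freshCount, set] at h1 h2 ⊢
  omega

/-- Labelling lowers `freshCount`, flipping removes a parent bit, and ending a path lowers `Y`. The
phase `clear` is excluded because its visits change the state at constant potential. -/
theorem potential_step {A : Fin n → Fin n → Bool} {k : ℕ} {st : SweepState n}
    (h : st.Inv A k) (hph : st.ph ≠ clear) (i j : Fin n) :
    st.step i j = st ∨ (st.step i j).potential < st.potential := by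
  have hP : ∀ s : SweepState n, (s.total fun m => m.p.toNat) ≤ n * n :=
    total_le fun m => m.p.toNat_le
  have hI := h.2
  match hb : st.ph with
  | start => simp [PhaseInv, hb] at hI
  | init => simp [PhaseInv, hb] at hI
  | clear => exact absurd hb hph
  | fin => exact Or.inl (step_eq_self (by simp [hb]) i j)
  | done => exact Or.inl (step_eq_self (by simp [hb]) i j)
  | mark b =>
    rcases step_mark hb i j with e | ⟨hy, hr, e⟩ | ⟨hr, ha, hx, hc, e⟩ | ⟨hc, hx, hr, e⟩ |
      ⟨hc, hz, e⟩
    · exact Or.inl e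
    all_goals
      right
      rw [e]
      have h1 := freshCount_set st i j (mark true, reached, st.c j, st.m i j)
      have h2 := freshCount_set st i j (mark true, reached, reached, { st.m i j with p := true })
      have hY : ∀ o : Phase × VertexMark × VertexMark × Cell, o.2.2.2.y = (st.m i j).y →
          ((st.set i j o).total fun m => m.y.toNat) = st.total fun m => m.y.toNat := by
        intro o ho
        have := total_set (fun m => m.y.toNat) st i j o
        rw [ho] at this
        omega
    · simp only [potential, hb, set_ph, hY (mark true, reached, st.c j, st.m i j) rfl]
      simp [hr] at h1
      omega
    · simp only [potential, hb, set_ph, hY (mark true, reached, reached,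
        { st.m i j with p := true }) rfl]
      simp [hr, hc] at h2
      omega
    · simp only [potential, hb, set_ph, hY (mark true, reached, reached,
        { st.m i j with p := true }) rfl]
      simp [hr, hc] at h2
      omega
    · simp only [potential, hb, set_ph, hY (trace, st.r i, active,
        { st.m i j with z := false }) rfl]
      have := hP (st.set i j (trace, st.r i, active, { st.m i j with z := false }))
      dsimp only at this ⊢
      omega
  | trace =>
    rcases step_trace hb i j with e | ⟨hc, hp, hx, e⟩ | ⟨hr, hy, e⟩ | ⟨hr, hp, hx, e⟩
    · exact Or.inl e
    · right
      rw [e]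
      have h1 := total_set (fun m => m.y.toNat) st i j
        (trace, active, reached, { st.m i j with x := true, p := false })
      have h2 := total_set (fun m => m.p.toNat) st i j
        (trace, active, reached, { st.m i j with x := true, p := false })
      simp only [hp, Bool.toNat_true, Bool.toNat_false, Nat.add_right_cancel_iff] at h1 h2
      simp only [potential, hb, set_ph, h1]
      omega
    · right
      rw [e]
      have h1 := total_set (fun m => m.y.toNat) st i j
        (fin, reached, st.c j, { st.m i j with y := false })
      simp only [hy, Bool.toNat_true, Bool.toNat_false, Nat.add_zero] at h1
      simp only [potential, hb, set_ph]
      rw [← h1, Nat.add_mul]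
      omega
    · right
      rw [e]
      have h1 := total_set (fun m => m.y.toNat) st i j
        (trace, reached, active, { st.m i j with x := false, p := false })
      have h2 := total_set (fun m => m.p.toNat) st i j
        (trace, reached, active, { st.m i j with x := false, p := false })
      simp only [hp, Bool.toNat_true, Bool.toNat_false, Nat.add_right_cancel_iff] at h1 h2
      simp only [potential, hb, set_ph, h1]
      omega

/-- The invariant in the phases other than `clear`, and preservation of those phases. -/
theorem inv_step {A : Fin n → Fin n → Bool} {k : ℕ} {st : SweepState n}
    (h : st.Inv A k ∧ st.ph ≠ clear) (i j : Fin n) :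
    (st.step i j).Inv A k ∧ (st.step i j).ph ≠ clear := by
  obtain ⟨h, hph⟩ := h
  have hI := h.2
  match hb : st.ph with
  | start => simp [PhaseInv, hb] at hI
  | init => simp [PhaseInv, hb] at hI
  | clear => exact absurd hb hph
  | fin => rw [step_eq_self (by simp [hb]) i j]; exact ⟨h, hph⟩
  | done => rw [step_eq_self (by simp [hb]) i j]; exact ⟨h, hph⟩
  | mark b =>
    refine ⟨inv_step_mark hb h i j, ?_⟩
    rcases step_mark hb i j with e | ⟨hy, hr, e⟩ | ⟨hr, ha, hx, hc, e⟩ | ⟨hc, hx, hr, e⟩ |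
      ⟨hc, hz, e⟩ <;> rw [e]
    · exact hph
    all_goals simp
  | trace =>
    refine ⟨inv_step_trace hb h i j, ?_⟩
    rcases step_trace hb i j with e | ⟨hc, hp, hx, e⟩ | ⟨hr, hy, e⟩ | ⟨hr, hp, hx, e⟩ <;> rw [e]
    · exact hph
    all_goals simp

theorem mem_pairs (i j : Fin n) :
    (i, j) ∈ (List.finRange n).flatMap fun i => (List.finRange n).map fun j => (i, j) := by
  simp

/-- Every genuine change leaves a phase other than `mark false`. -/
theorem step_eq_self_of_ph {st : SweepState n} {i j : Fin n}
    (h : (st.step i j).ph = mark false) : st.step i j = st := by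
  match hb : st.ph with
  | start => exact step_eq_self (by simp [hb]) i j
  | init => simp [step, hb, localStep] at h
  | clear => simp [step, hb, localStep] at h
  | fin => exact step_eq_self (by simp [hb]) i j
  | done => exact step_eq_self (by simp [hb]) i j
  | mark b =>
    rcases step_mark hb i j with e | ⟨-, -, e⟩ | ⟨-, -, -, -, e⟩ | ⟨-, -, -, e⟩ | ⟨-, -, e⟩
    · exact e
    all_goals simp [e] at h
  | trace =>
    rcases step_trace hb i j with e | ⟨-, -, -, e⟩ | ⟨-, -, e⟩ | ⟨-, -, -, e⟩
    · exact e
    all_goals simp [e] at h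

/-- Each failure of `Closed` would let one of the four rules of `mark` fire. -/
theorem closed_of_fixed {st : SweepState n} (hb : st.ph = mark false)
    (h : ∀ i j, st.step i j = st) : st.Closed := by
  have key : ∀ i j, _ := fun i j => localStep_eq_of_step_eq (h i j)
  simp only [hb, localStep] at key
  constructor
  · intro i j hy hr
    have := key i j
    rw [if_pos ⟨hy, hr⟩] at this
    simp at this
  · intro i j hr ha hx hc
    have := key i j
    rw [if_neg (by simp [hr]), if_pos ⟨hr, ha, hx, hc⟩] at this
    simp at this
  · intro i j hc hx hr
    have := key i j
    split_ifs at this <;> simp_all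
  · intro i j hc
    by_contra hz
    rw [Bool.not_eq_false] at hz
    have := key i j
    split_ifs at this <;> simp_all

/-- The active vertex lies within the rank bound, so it has a parent or a free slot, and a rule of
`trace` fires there. Hence tracing never stalls. -/
theorem not_fixed_trace {A : Fin n → Fin n → Bool} {k : ℕ} {st : SweepState n}
    (hb : st.ph = trace) (hI : st.Inv A k) : ¬ ∀ i j, st.step i j = st := by
  intro h
  have key : ∀ i j, _ := fun i j => localStep_eq_of_step_eq (h i j)
  simp only [hb, localStep] at key
  obtain ⟨-, hI⟩ := hI
  simp only [PhaseInv, hb] at hI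
  obtain ⟨ρ, v, hv, hS, hF⟩ := hI
  rcases v with i | j
  · rw [status_inl] at hv
    have hne : ∀ j, st.c j ≠ active := fun j => (hS (.inr j) (by simp)).ne_active
    rcases hF.row i (by rw [hv]; decide) le_rfl with ⟨j, hy⟩ | ⟨j, hp, hx⟩
    · have := key i j
      rw [if_neg fun h => hne j h.1, if_pos ⟨hv, hy⟩] at this
      simp at this
    · have := key i j
      rw [if_neg fun h => hne j h.1] at this
      split_ifs at this <;> simp_all
  · rw [status_inr] at hv
    obtain ⟨i, hp, hx⟩ := hF.col j (by rw [hv]; decide) le_rfl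
    have := key i j
    rw [if_pos ⟨hv, hp, hx⟩] at this
    simp [hv] at this

/-- A sweep in the phase `clear` removes all labels. -/
theorem sweepRows_clear {A : Fin n → Fin n → Bool} {k : ℕ} {st : SweepState n}
    (hb : st.ph = clear) (h : st.Inv A k) :
    let s := st.sweepRows (List.finRange n)
    s.ph = clear ∧ s.Balanced A k ∧ (s.total fun m => m.y.toNat) = (st.total fun m => m.y.toNat) ∧
      ∀ i j, s.r i = fresh ∧ s.c j = fresh ∧ (s.m i j).p = false := by
  intro s
  have hstep : ∀ {s : SweepState n} (_ : s.ph = clear) (i j : Fin n),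
      s.step i j = s.set i j (clear, fresh, fresh, { s.m i j with p := false }) := by
    intro s hs i j
    unfold step
    rw [hs]
    rfl
  let P : SweepState n → Prop := fun s => s.ph = clear ∧ s.Balanced A k ∧
    (∀ u, s.status u ≠ active) ∧
    (s.total fun m => m.y.toNat) = (st.total fun m => m.y.toNat)
  have hP : ∀ (s : SweepState n) (a : Fin n × Fin n), P s → P (s.step a.1 a.2) := by
    rintro s ⟨i, j⟩ ⟨h1, h2, h3, h4⟩
    have hri := h3 (.inl i)
    have hcj := h3 (.inr j)
    rw [status_inl] at hri
    rw [status_inr] at hcj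
    rw [hstep h1]
    refine ⟨rfl, h2.set i j rfl (h2.sub i j) (by simp [hri]) (by simp [hcj]), ?_, ?_⟩
    · intro u
      rw [set_status]
      split_ifs
      · simp
      · simp
      · exact h3 u
    · have := total_set (fun m => m.y.toNat) s i j (clear, fresh, fresh, { s.m i j with p := false })
      dsimp only at this ⊢
      omega
  have h0 : P st := ⟨hb, h.1, by simpa [PhaseInv, hb] using h.2, rfl⟩
  have e : s = _ := sweepRows_eq st (List.finRange n)
  have hPs : P s := e ▸ foldl_invariant hP _ h0
  refine ⟨hPs.1, hPs.2.1, hPs.2.2.2, fun i j => ?_⟩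
  rw [e]
  refine foldl_establish (P := P) (Q := fun (a : Fin n × Fin n) s => s.r a.1 = fresh ∧
    s.c a.2 = fresh ∧ (s.m a.1 a.2).p = false) hP ?_ ?_ _ h0 _ (mem_pairs i j)
  · rintro s ⟨i, j⟩ hs
    rw [hstep hs.1]
    simp [set_r, set_c, set_m]
  · rintro s ⟨i, j⟩ ⟨i', j'⟩ hs ⟨h1, h2, h3⟩
    rw [hstep hs.1]
    simp only [set_r, set_c, set_m]
    refine ⟨?_, ?_, ?_⟩ <;> split_ifs <;> first | rfl | assumption

/-- Every sweep preserves the invariant and decreases the potential. -/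
theorem inv_sweep {A : Fin n → Fin n → Bool} {k : ℕ} {st : SweepState n} (h : st.Inv A k)
    (hm : st.ph ≠ mark true) (hd : st.ph ≠ done) :
    st.sweep.Inv A k ∧ st.sweep.ph ≠ mark true ∧ st.sweep.potential < st.potential := by
  by_cases hc : st.ph = clear
  · obtain ⟨h1, h2, h3, h4⟩ := sweepRows_clear hc h
    have hph : st.sweep.ph = mark false := by
      simp [sweep, endSweep, h1, Phase.next]
    have hfresh : ∀ u, st.sweep.status u = fresh := by
      rintro (i | j)
      · exact (h4 i i).1
      · exact (h4 j j).2.1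
    refine ⟨⟨⟨h2.adj, h2.sub, h2.row, h2.col⟩, ?_⟩, by simp [hph], ?_⟩
    · simp only [PhaseInv, hph]
      refine ⟨fun u => Or.inl (hfresh u), fun _ => 0, 0, fun _ => le_rfl, ?_⟩
      have hp : ∀ i j, (st.sweep.m i j).p = false := fun i j => (h4 i j).2.2
      have hr : ∀ i, st.sweep.r i = fresh := fun i => hfresh (.inl i)
      have hc : ∀ j, st.sweep.c j = fresh := fun j => hfresh (.inr j)
      constructor <;> simp [hp, hr, hc]
    · have h5 : (st.sweep.total fun m => m.y.toNat) = st.total fun m => m.y.toNat := h3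
      have := freshCount_le st.sweep
      simp only [potential, hph, hc, h5]
      omega
  · have hP : ∀ (s : SweepState n) (a : Fin n × Fin n), s.Inv A k ∧ s.ph ≠ clear →
        (s.step a.1 a.2).Inv A k ∧ (s.step a.1 a.2).ph ≠ clear := fun s a hs =>
      inv_step hs a.1 a.2
    have h1 := foldl_invariant hP ((List.finRange n).flatMap fun i =>
      (List.finRange n).map fun j => (i, j)) ⟨h, hc⟩
    have h2 := foldl_fixed_or_lt potential hP
      (fun s a hs => potential_step hs.1 hs.2 a.1 a.2) ((List.finRange n).flatMap fun i =>
      (List.finRange n).map fun j => (i, j)) ⟨h, hc⟩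
    -- A sweep that ends its visits in `mark false` was idle, so that ending is incompatible with a
    -- drop of the potential.
    have h4 := foldl_invariant (P := fun s => s.ph = mark false → s = st)
      (f := fun s (a : Fin n × Fin n) => s.step a.1 a.2)
      (fun s a hs ha => by
        have e := step_eq_self_of_ph ha
        rw [e] at ha
        exact e.trans (hs ha))
      ((List.finRange n).flatMap fun i => (List.finRange n).map fun j => (i, j)) (fun _ => rfl)
    rw [← sweepRows_eq] at h1 h2 h4
    unfold sweep
    obtain ⟨hI, hsc⟩ := h1
    rcases h2 with ⟨h2, h3⟩ | h2
    · have hfix : ∀ i j, st.step i j = st := fun i j => h3 _ (mem_pairs i j)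
      rw [h2]
      obtain ⟨hB, hI⟩ := h
      match hb : st.ph with
      | start => simp [PhaseInv, hb] at hI
      | init => simp [PhaseInv, hb] at hI
      | clear => exact absurd hb hc
      | done => exact absurd hb hd
      | mark true => exact absurd hb hm
      | fin =>
        simp only [PhaseInv, hb] at hI
        simp only [Inv, PhaseInv, endSweep, potential, hb, Phase.next]
        exact ⟨⟨⟨hB.adj, hB.sub, hB.row, hB.col⟩, hI⟩, by simp, by
          simp only [total]
          omega⟩
      | trace => exact absurd hfix (not_fixed_trace hb ⟨hB, hI⟩)
      | mark false =>
        have hcl := closed_of_fixed hb hfix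
        simp only [PhaseInv, hb] at hI
        simp only [Inv, PhaseInv, endSweep, potential, hb, Phase.next]
        exact ⟨⟨⟨hB.adj, hB.sub, hB.row, hB.col⟩, hI.1,
          ⟨hcl.root, hcl.forward, hcl.backward, hcl.exit⟩⟩, by simp, by omega⟩
    · generalize st.sweepRows (List.finRange n) = s at *
      obtain ⟨hB, hI⟩ := hI
      match hb : s.ph with
      | start => simp [PhaseInv, hb] at hI
      | init => simp [PhaseInv, hb] at hI
      | clear => exact absurd hb hsc
      | done =>
        simp only [PhaseInv, hb] at hI
        simp only [Inv, PhaseInv, endSweep, hb, Phase.next]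
        refine ⟨⟨⟨hB.adj, hB.sub, hB.row, hB.col⟩, hI.1,
          ⟨hI.2.root, hI.2.forward, hI.2.backward, hI.2.exit⟩⟩, by simp, ?_⟩
        simpa [potential, hb] using h2
      | fin =>
        simp only [PhaseInv, hb] at hI
        simp only [Inv, PhaseInv, endSweep, hb, Phase.next]
        refine ⟨⟨⟨hB.adj, hB.sub, hB.row, hB.col⟩, hI⟩, by simp, lt_trans ?_ h2⟩
        simp only [potential, total, hb]
        omega
      | trace =>
        simp only [PhaseInv, hb] at hI
        have : s.endSweep = s := by simp [endSweep, hb, Phase.next, SweepState.ext_iff]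
        rw [this]
        exact ⟨⟨hB, by simpa only [PhaseInv, hb] using hI⟩, by simp [hb], h2⟩
      | mark true =>
        simp only [PhaseInv, hb] at hI
        simp only [Inv, PhaseInv, endSweep, hb, Phase.next]
        obtain ⟨hS, ρ, L, hL, hF⟩ := hI
        refine ⟨⟨⟨hB.adj, hB.sub, hB.row, hB.col⟩, hS, ρ, L, hL,
          ⟨hF.labelled, hF.adj, hF.col_gt, hF.row_gt, hF.row, hF.col⟩⟩, by simp, ?_⟩
        simpa only [potential, total, freshCount, hb] using h2
      | mark false =>
        rw [h4 hb] at h2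
        exact absurd h2 (lt_irrefl _)

end SweepState

end Algorithm

/-! ### Initialisation, and optimality of the final matrix. -/

section Algorithm

open VertexMark Phase

namespace SweepState

variable {n : ℕ}

/-- The state in which the machine starts to sweep. -/
def initial (A : Fin n → Fin n → Bool) (v : Fin n → VertexMark) : SweepState n where
  ph := init
  r := v
  c := v
  m i j := ⟨A i j, false, false, false, false⟩

/-- The first sweep installs the capacities. -/
theorem inv_sweep_initial {k : ℕ} (A : Fin n → Fin n → Bool) (v : Fin n → VertexMark)
    (hv : ∀ i, v i ≠ active) (hk : (Finset.univ.filter fun i => v i = full).card = k) :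
    (initial A v).sweep.Inv A k ∧ (initial A v).sweep.ph = clear := by
  have hstep : ∀ {s : SweepState n} (_ : s.ph = init) (i j : Fin n), s.step i j =
      s.set i j (init, s.r i, s.c j, { s.m i j with y := s.c j = full, z := s.r i = full }) := by
    intro s hs i j
    unfold step
    rw [hs]
    rfl
  let P : SweepState n → Prop := fun s => s.ph = init ∧ s.r = v ∧ s.c = v ∧
    ∀ i j, (s.m i j).a = A i j ∧ (s.m i j).x = false ∧ (s.m i j).p = false
  have hP : ∀ (s : SweepState n) (a : Fin n × Fin n), P s → P (s.step a.1 a.2) := by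
    rintro s ⟨i, j⟩ ⟨h1, h2, h3, h4⟩
    rw [hstep h1]
    refine ⟨rfl, ?_, ?_, ?_⟩
    · rw [← h2]
      simp [set]
    · rw [← h3]
      simp [set]
    · intro i' j'
      rw [set_m]
      split_ifs with h
      · obtain ⟨rfl, rfl⟩ := h
        exact h4 i' j'
      · exact h4 i' j'
  have h0 : P (initial A v) := ⟨rfl, rfl, rfl, fun i j => ⟨rfl, rfl, rfl⟩⟩
  have e := sweepRows_eq (initial A v) (List.finRange n)
  have hPs : P ((initial A v).sweepRows (List.finRange n)) := e ▸ foldl_invariant hP _ h0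
  have hQ : ∀ i j, ((((initial A v).sweepRows (List.finRange n)).m i j).y = decide (v j = full)) ∧
      ((((initial A v).sweepRows (List.finRange n)).m i j).z = decide (v i = full)) := by
    intro i j
    rw [e]
    refine foldl_establish (P := P) (Q := fun (a : Fin n × Fin n) s =>
      ((s.m a.1 a.2).y = decide (v a.2 = full)) ∧ ((s.m a.1 a.2).z = decide (v a.1 = full)))
      hP ?_ ?_ _ h0 _ (mem_pairs i j)
    · rintro s ⟨i, j⟩ ⟨h1, h2, h3, -⟩
      rw [hstep h1]
      simp [set_m, h2, h3]
    · rintro s ⟨i, j⟩ ⟨i', j'⟩ ⟨h1, h2, h3, -⟩ ⟨h5, h6⟩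
      rw [hstep h1]
      simp only [set_m]
      split_ifs with h
      · obtain ⟨rfl, rfl⟩ := h
        simp [h2, h3]
      · exact ⟨h5, h6⟩
  have hph : (initial A v).sweep.ph = clear := by
    simp [sweep, endSweep, hPs.1, Phase.next]
  refine ⟨⟨?_, ?_⟩, hph⟩
  · have hr : ∀ i, (initial A v).sweep.r i ≠ active := fun i => by
      rw [show (initial A v).sweep.r = v from hPs.2.1]
      exact hv i
    have hc : ∀ i, (initial A v).sweep.c i ≠ active := fun i => by
      rw [show (initial A v).sweep.c = v from hPs.2.2.1]
      exact hv i
    have hx : ∀ i j, ((initial A v).sweep.m i j).x = false := fun i j => (hPs.2.2.2 i j).2.1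
    have hy : ∀ i j, ((initial A v).sweep.m i j).y = decide (v j = full) := fun i j => (hQ i j).1
    have hz : ∀ i j, ((initial A v).sweep.m i j).z = decide (v i = full) := fun i j => (hQ i j).2
    have hsum : ∑ i, (decide (v i = full)).toNat = k := by
      rw [← hk, Finset.card_filter]
      exact Finset.sum_congr rfl fun i _ => by by_cases h : v i = full <;> simp [h]
    refine ⟨fun i j => (hPs.2.2.2 i j).1, fun i j h => ?_, fun i => ?_, fun j => ?_⟩
    · rw [hx] at h
      exact absurd h (by simp)
    · rw [if_neg (hr i)]
      simp [hx, hy, hsum]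
    · rw [if_neg (hc j)]
      simp [hx, hz, hsum]
  · simp only [PhaseInv, hph]
    rintro (i | j)
    · rw [status_inl, show (initial A v).sweep.r = v from hPs.2.1]
      exact hv i
    · rw [status_inr, show (initial A v).sweep.c = v from hPs.2.2.1]
      exact hv j

/-- When the algorithm stops, the matrix `x` is optimal. -/
theorem card_le_of_closed {A : Fin n → Fin n → Bool} {k : ℕ} {st : SweepState n}
    (hB : st.Balanced A k) (hS : ∀ u, Settled (st.status u)) (hC : st.Closed)
    (X : Fin n → Fin n → Bool) (hA : ∀ i j, X i j → A i j)
    (hr : ∀ i, ∑ j, (X i j).toNat ≤ k) (hc : ∀ j, ∑ i, (X i j).toNat ≤ k) :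
    ∑ i, ∑ j, (X i j).toNat ≤ ∑ i, ∑ j, (st.m i j).x.toNat := by
  have hri : ∀ i, st.r i = fresh ∨ st.r i = reached := fun i => hS (.inl i)
  have hcj : ∀ j, st.c j = fresh ∨ st.c j = reached := fun j => hS (.inr j)
  -- Dual solution: weight 1 on unreached rows, on reached columns, and on adjacent pairs from a
  -- reached row to a fresh column. It bounds every feasible `X` (`h1`); for the final `x` it is
  -- tight entrywise (`h2`) and on the weighted rows and columns, which are saturated (`h3`, `h4`).
  let u : Fin n → ℕ := fun i => if st.r i = reached then 0 else 1
  let t : Fin n → ℕ := fun j => if st.c j = reached then 1 else 0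
  let e : Fin n → Fin n → ℕ := fun i j =>
    if st.r i = reached ∧ st.c j = fresh then (A i j).toNat else 0
  have h1 : ∀ i j, (X i j).toNat ≤ u i * (X i j).toNat + t j * (X i j).toNat + e i j := by
    intro i j
    have := hA i j
    rcases hri i with h | h <;> rcases hcj j with h' | h' <;>
      cases hX : X i j <;> simp_all [u, t, e]
  have h2 : ∀ i j, (st.m i j).x.toNat =
      u i * (st.m i j).x.toNat + t j * (st.m i j).x.toNat + e i j := by
    intro i j
    have hf := hC.forward i j
    have hb := hC.backward i j
    have ha := hB.adj i j
    have hs := hB.sub i j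
    rcases hri i with h | h <;> rcases hcj j with h' | h' <;>
      cases hx : (st.m i j).x <;> simp_all [u, t, e]
  have key : ∀ Z : Fin n → Fin n → ℕ, ∑ i, ∑ j, (u i * Z i j + t j * Z i j + e i j) =
      ∑ i, u i * ∑ j, Z i j + ∑ j, t j * ∑ i, Z i j + ∑ i, ∑ j, e i j := by
    intro Z
    simp only [Finset.sum_add_distrib, Finset.mul_sum]
    rw [Finset.sum_comm (f := fun i j => t i * Z j i)]
  have h3 : ∀ i, u i * ∑ j, (st.m i j).x.toNat = u i * k := by
    intro i
    rcases hri i with h | h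
    · have hrow := hB.row i
      have hy : ∀ j, (st.m i j).y = false := fun j => by
        by_contra hy
        exact hC.root i j (by simpa using hy) h
      simp only [hy, h] at hrow
      simp only [Bool.toNat_false, add_zero, reduceCtorEq, if_false] at hrow
      rw [hrow]
    · simp [u, h]
  have h4 : ∀ j, t j * ∑ i, (st.m i j).x.toNat = t j * k := by
    intro j
    rcases hcj j with h | h
    · simp [t, h]
    · have hcol := hB.col j
      have hz : ∀ i, (st.m i j).z = false := fun i => hC.exit i j h
      simp only [hz, h] at hcol
      simp only [Bool.toNat_false, add_zero, reduceCtorEq, if_false] at hcol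
      rw [hcol]
  calc ∑ i, ∑ j, (X i j).toNat
      ≤ ∑ i, ∑ j, (u i * (X i j).toNat + t j * (X i j).toNat + e i j) :=
        Finset.sum_le_sum fun i _ => Finset.sum_le_sum fun j _ => h1 i j
    _ = ∑ i, u i * ∑ j, (X i j).toNat + ∑ j, t j * ∑ i, (X i j).toNat + ∑ i, ∑ j, e i j :=
        key fun i j => (X i j).toNat
    _ ≤ ∑ i, u i * k + ∑ j, t j * k + ∑ i, ∑ j, e i j := by
        gcongr with i _ j _
        · exact hr i
        · exact hc j
    _ = ∑ i, ∑ j, (st.m i j).x.toNat := by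
        rw [Finset.sum_congr rfl fun i _ => Finset.sum_congr rfl fun j _ => h2 i j,
          key fun i j => (st.m i j).x.toNat, Finset.sum_congr rfl fun i _ => h3 i,
          Finset.sum_congr rfl fun j _ => h4 j]

theorem sum_toNat {ι : Type*} [Fintype ι] (f : ι → Bool) :
    ∑ i, (f i).toNat = (Finset.univ.filter fun i => f i = true).card := by
  rw [Finset.card_filter]
  exact Finset.sum_congr rfl fun i _ => by cases f i <;> rfl

/-- When the algorithm stops, the number of ones of `x` is `2 ν_k(G)`. -/
theorem total_eq_two_mul_nu {G : SimpleGraph (Fin n)} (hG : G.IsBipartite) {k : ℕ}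
    {A : Fin n → Fin n → Bool} (hA : ∀ i j, A i j = true ↔ G.Adj i j) {st : SweepState n}
    (h : st.Inv A (min k n)) (hd : st.ph = done) :
    (st.total fun m => m.x.toNat) = 2 * nu k G := by
  obtain ⟨hB, hI⟩ := h
  simp only [PhaseInv, hd] at hI
  obtain ⟨hS, hC⟩ := hI
  have hpair : ∀ X : Fin n → Fin n → Bool, ∑ i, ∑ j, (X i j).toNat =
      (Finset.univ.filter fun p : Fin n × Fin n => X p.1 p.2 = true).card := by
    intro X
    rw [← sum_toNat, Fintype.sum_prod_type]
  -- A line has only `n` entries, so the capacities `k` and `min k n` impose the same constraint.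
  have hle : ∀ (f : Fin n → Bool), (Finset.univ.filter fun i => f i = true).card ≤ k →
      ∑ i, (f i).toNat ≤ min k n := by
    intro f hf
    rw [sum_toNat]
    exact le_min hf ((Finset.card_le_univ _).trans (by simp))
  unfold total
  rw [hpair]
  refine card_eq_two_mul_nu G hG (fun i j => (st.m i j).x)
    (fun i j h => (hA i j).1 (hB.sub i j h)) (fun i => ?_) (fun j => ?_) ?_
  · rw [← sum_toNat]
    have h1 := hB.row i
    have h2 : st.r i ≠ active := (hS (.inl i)).ne_active
    rw [if_neg h2, Finset.sum_add_distrib] at h1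
    omega
  · rw [← sum_toNat (fun i => (st.m i j).x)]
    have h1 := hB.col j
    have h2 : st.c j ≠ active := (hS (.inr j)).ne_active
    rw [if_neg h2, Finset.sum_add_distrib] at h1
    omega
  · intro X hX hr hc
    rw [← hpair, ← hpair fun i j => (st.m i j).x]
    exact card_le_of_closed hB hS hC X (fun i j h => (hA i j).2 (hX i j h))
      (fun i => hle _ (hr i)) (fun j => hle _ (hc j))

end SweepState

end Algorithm

/-! ### The stack machine, its program and its elementary loops. -/

section Machine

open VertexMark Phase Turing

/-- The stacks of the machine. -/
inductive Stk
  | inp | out | row | rowAux | col | colAux | mat | matAux | cnt | tmp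
  deriving DecidableEq

instance : Fintype Stk where
  elems := {.inp, .out, .row, .rowAux, .col, .colAux, .mat, .matAux, .cnt, .tmp}
  complete x := by cases x <;> decide

/-- The stack alphabets. -/
@[reducible] def Alphabet : Stk → Type
  | .inp => Option Bool ⊕ Bool
  | .out | .cnt | .tmp => Bool
  | .row | .rowAux | .col | .colAux => VertexMark
  | .mat | .matAux => Cell

/-- The labels of the program. -/
inductive Label
  | parse | revCnt | dec | borrow | restore | zero
  | sweepRow | entry | backCol | backRow | backMat
  | clean | count | inc | carry | final
  deriving DecidableEq

instance : Fintype Label where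
  elems := {.parse, .revCnt, .dec, .borrow, .restore, .zero, .sweepRow, .entry, .backCol, .backRow,
    .backMat, .clean, .count, .inc, .carry, .final}
  complete x := by cases x <;> decide

/-- The internal memory of the machine: the phase, and the symbols just read. -/
structure Memory where
  ph : Phase
  i : Option (Option Bool ⊕ Bool)
  r : Option VertexMark
  c : Option VertexMark
  m : Option Cell
  b : Option Bool

noncomputable instance : Fintype Memory :=
  Fintype.ofInjective (fun s : Memory => (s.ph, s.i, s.r, s.c, s.m, s.b)) (by
    rintro ⟨⟩ ⟨⟩ h
    simpa using h)

/-- Memory without symbols. -/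
def Memory.idle (q : Phase) : Memory := ⟨q, none, none, none, none, none⟩

/-- The cell described by an input symbol. -/
def symCell : Option Bool ⊕ Bool → Option Cell
  | .inl (some b) => some ⟨b, false, false, false, false⟩
  | _ => none

/-- The row described by an input symbol. -/
def symRow : Option Bool ⊕ Bool → Option VertexMark
  | .inl none => some fresh
  | _ => none

/-- The result of a visit to the entry held in memory. -/
def Memory.visit (s : Memory) : Phase × VertexMark × VertexMark × Cell :=
  localStep s.ph (s.r.getD fresh) (s.c.getD fresh)
    (s.m.getD ⟨false, false, false, false, false⟩)

open TM2.Stmt in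
/-- Forget the symbols read and go to a label. -/
def jump (l : Label) : TM2.Stmt Alphabet Label Memory :=
  load (fun s => .idle s.ph) <| goto fun _ => l

open TM2.Stmt in
/-- Move the top symbol from one stack to another and repeat; when there is none, do `q`. -/
def moveBit (k k' : Stk) (hk : Alphabet k = Bool) (hk' : Alphabet k' = Bool) (l : Label)
    (q : TM2.Stmt Alphabet Label Memory) : TM2.Stmt Alphabet Label Memory :=
  pop k (fun s a => { s with b := a.map (cast hk) }) <|
  branch (fun s => s.b.isNone) q <|
  push k' (fun s => cast hk'.symm (s.b.getD false)) <| jump l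

open TM2.Stmt in
/-- The program of the machine. -/
def program : Label → TM2.Stmt Alphabet Label Memory
  | .parse =>
    pop .inp (fun s a => { s with i := a }) <|
    branch (fun s => s.i.isNone) (jump .revCnt) <|
    branch (fun s => (s.i.bind symCell).isSome)
      (push .matAux (fun s => (s.i.bind symCell).getD ⟨false, false, false, false, false⟩) <|
        jump .parse) <|
    branch (fun s => (s.i.bind symRow).isSome)
      (push .rowAux (fun s => (s.i.bind symRow).getD fresh) <| jump .parse) <|
    push .tmp (fun s => (s.i.bind Sum.getRight?).getD false) <| jump .parse
  | .revCnt => moveBit .tmp .cnt rfl rfl .revCnt (jump .dec)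
  -- `rowAux` holds one mark per vertex. Each mark costs one decrement of the counter and yields
  -- `full` until the counter is zero, `fresh` afterwards. Then `backMat` turns the phase `start`
  -- into `init`.
  | .dec =>
    pop .rowAux (fun s a => { s with r := a }) <|
    branch (fun s => s.r.isNone) (jump .backMat) (jump .borrow)
  | .borrow =>
    pop .cnt (fun s a => { s with b := a }) <|
    branch (fun s => s.b.isNone) (jump .zero) <|
    branch (fun s => s.b.getD false) (push .cnt (fun _ => false) <| jump .restore) <|
    push .tmp (fun _ => true) <| jump .borrow
  | .restore => moveBit .tmp .cnt rfl rfl .restore <|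
    push .row (fun _ => full) <| push .col (fun _ => full) <| jump .dec
  | .zero =>
    pop .tmp (fun s a => { s with b := a }) <|
    branch (fun s => s.b.isNone)
      (push .row (fun _ => fresh) <| push .col (fun _ => fresh) <| jump .dec) <| jump .zero
  | .sweepRow =>
    peek .row (fun s a => { s with r := a }) <|
    branch (fun s => s.r.isNone) (jump .backRow) (jump .entry)
  | .entry =>
    pop .row (fun s a => { s with r := a }) <|
    pop .col (fun s a => { s with c := a }) <|
    branch (fun s => s.c.isNone) (push .rowAux (fun s => s.r.getD fresh) <| jump .backCol) <|
    pop .mat (fun s a => { s with m := a }) <|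
    -- The phase is stored last, so all these pushes see the result of the same visit.
    push .row (fun s => s.visit.2.1) <|
    push .colAux (fun s => s.visit.2.2.1) <|
    push .matAux (fun s => s.visit.2.2.2) <|
    load (fun s => { s with ph := s.visit.1 }) <| jump .entry
  | .backCol =>
    pop .colAux (fun s a => { s with c := a }) <|
    branch (fun s => s.c.isNone) (jump .sweepRow) <|
    push .col (fun s => s.c.getD fresh) <| jump .backCol
  | .backRow =>
    pop .rowAux (fun s a => { s with r := a }) <|
    branch (fun s => s.r.isNone) (jump .backMat) <|
    push .row (fun s => s.r.getD fresh) <| jump .backRow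
  | .backMat =>
    pop .matAux (fun s a => { s with m := a }) <|
    branch (fun s => s.m.isNone)
      (load (fun s => { s with ph := s.ph.next }) <|
        branch (fun s => s.ph = done) (jump .clean) (jump .sweepRow)) <|
    push .mat (fun s => s.m.getD ⟨false, false, false, false, false⟩) <| jump .backMat
  -- A halting configuration must have all stacks but the output empty.
  | .clean =>
    pop .row (fun s a => { s with r := a }) <|
    pop .col (fun s a => { s with c := a }) <|
    pop .cnt (fun s a => { s with b := a }) <|
    branch (fun s => s.r.isNone && s.c.isNone && s.b.isNone) (jump .count) (jump .clean)
  | .count =>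
    pop .mat (fun s a => { s with m := a }) <|
    branch (fun s => s.m.isNone) (jump .final) <|
    branch (fun s => s.m.any Cell.x) (jump .inc) (jump .count)
  | .inc =>
    pop .out (fun s a => { s with b := a }) <|
    -- An exhausted stack reads as the digit 0, so a final carry creates a new top bit.
    branch (fun s => s.b.getD false) (push .tmp (fun _ => false) <| jump .inc) <|
    push .out (fun _ => true) <| jump .carry
  | .carry => moveBit .tmp .out rfl rfl .carry (jump .count)
  -- The lowest bit lies on top; popping it halves the count. The memory returns to its initial
  -- state, as halting requires.
  | .final =>
    pop .out (fun s _ => s) <|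
    load (fun _ => .idle start) halt

/-- The contents of the stacks. -/
structure Stacks where
  inp : List (Option Bool ⊕ Bool) := []
  out : List Bool := []
  row : List VertexMark := []
  rowAux : List VertexMark := []
  col : List VertexMark := []
  colAux : List VertexMark := []
  mat : List Cell := []
  matAux : List Cell := []
  cnt : List Bool := []
  tmp : List Bool := []

/-- The contents of a given stack. -/
def Stacks.get (S : Stacks) : ∀ k, List (Alphabet k)
  | .inp => S.inp
  | .out => S.out
  | .row => S.row
  | .rowAux => S.rowAux
  | .col => S.col
  | .colAux => S.colAux
  | .mat => S.mat
  | .matAux => S.matAux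
  | .cnt => S.cnt
  | .tmp => S.tmp

/-- The configuration at a label. -/
def cfg (l : Label) (q : Phase) (S : Stacks) : TM2.Cfg Alphabet Label Memory :=
  ⟨some l, .idle q, S.get⟩

/-- The machine gets from `a` to `b` in at most `t` steps. -/
def Within (t : ℕ) (a b : TM2.Cfg Alphabet Label Memory) : Prop :=
  ∃ s ≤ t, (flip bind (TM2.step program))^[s] (some a) = some b

theorem Within.refl (a) : Within 0 a a := ⟨0, le_rfl, rfl⟩

theorem Within.mono {t t' : ℕ} {a b} (h : Within t a b) (ht : t ≤ t') : Within t' a b :=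
  let ⟨s, hs, e⟩ := h
  ⟨s, hs.trans ht, e⟩

theorem Within.trans {t t' : ℕ} {a b c} (h : Within t a b) (h' : Within t' b c) :
    Within (t + t') a c := by
  obtain ⟨s, hs, e⟩ := h
  obtain ⟨s', hs', e'⟩ := h'
  exact ⟨s' + s, by omega, by rw [Function.iterate_add_apply, e, e']⟩

/-- Execute one step, then continue. -/
theorem Within.head {t : ℕ} {l l' : Label} {q q' : Phase} {S S' : Stacks} {c}
    (h : Within t (cfg l' q' S') c)
    (hl : (TM2.stepAux (program l) (.idle q) S.get).l = some l' := by rfl)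
    (hq : (TM2.stepAux (program l) (.idle q) S.get).var = .idle q' := by rfl)
    (hS : ∀ k, (TM2.stepAux (program l) (.idle q) S.get).stk k = S'.get k := by
      intro k; cases k <;> rfl) :
    Within (t + 1) (cfg l q S) c := by
  obtain ⟨s, hs, e⟩ := h
  refine ⟨s + 1, by omega, ?_⟩
  rw [Function.iterate_succ_apply, ← e]
  congr 1
  change some (TM2.stepAux (program l) (.idle q) S.get) = some ⟨some l', .idle q', S'.get⟩
  rw [← hl, ← hq, ← funext hS]

theorem within_parse (q : Phase) (w : List (Option Bool ⊕ Bool)) (S : Stacks) :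
    Within (w.length + 1) (cfg .parse q { S with inp := w })
      (cfg .revCnt q { S with
        inp := []
        matAux := (w.filterMap symCell).reverse ++ S.matAux
        rowAux := (w.filterMap symRow).reverse ++ S.rowAux
        tmp := (w.filterMap Sum.getRight?).reverse ++ S.tmp }) := by
  induction w generalizing S with
  | nil => exact .head (.refl _)
  | cons a w ih =>
    rcases a with (_ | b) | b
    · refine .head (S' := { S with inp := w, rowAux := fresh :: S.rowAux }) (q' := q) ?_
      simpa [List.filterMap_cons, symRow, symCell] using ih { S with rowAux := fresh :: S.rowAux }
    · refine .head (S' := { S with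
        inp := w, matAux := ⟨b, false, false, false, false⟩ :: S.matAux }) (q' := q) ?_
      simpa [List.filterMap_cons, symRow, symCell] using ih { S with
        matAux := ⟨b, false, false, false, false⟩ :: S.matAux }
    · refine .head (S' := { S with inp := w, tmp := b :: S.tmp }) (q' := q) ?_
      simpa [List.filterMap_cons, symRow, symCell] using ih { S with tmp := b :: S.tmp }

theorem within_revCnt (q : Phase) (w : List Bool) (S : Stacks) :
    Within (w.length + 1) (cfg .revCnt q { S with tmp := w })
      (cfg .dec q { S with tmp := [], cnt := w.reverse ++ S.cnt }) := by
  induction w generalizing S with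
  | nil => exact .head (.refl _)
  | cons b w ih =>
    refine .head (S' := { S with tmp := w, cnt := b :: S.cnt }) (q' := q) ?_
    simpa using ih { S with cnt := b :: S.cnt }

theorem within_restore (q : Phase) (w : List Bool) (S : Stacks) :
    Within (w.length + 1) (cfg .restore q { S with tmp := w })
      (cfg .dec q { S with
        tmp := [], cnt := w.reverse ++ S.cnt, row := full :: S.row, col := full :: S.col }) := by
  induction w generalizing S with
  | nil => exact .head (.refl _)
  | cons b w ih =>
    refine .head (S' := { S with tmp := w, cnt := b :: S.cnt }) (q' := q) ?_
    simpa using ih { S with cnt := b :: S.cnt }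

theorem within_zero (q : Phase) (w : List Bool) (S : Stacks) :
    Within (w.length + 1) (cfg .zero q { S with tmp := w })
      (cfg .dec q { S with tmp := [], row := fresh :: S.row, col := fresh :: S.col }) := by
  induction w generalizing S with
  | nil => exact .head (.refl _)
  | cons b w ih => exact .head (S' := { S with tmp := w }) (q' := q) (ih S)

theorem within_backCol (q : Phase) (w : List VertexMark) (S : Stacks) :
    Within (w.length + 1) (cfg .backCol q { S with colAux := w })
      (cfg .sweepRow q { S with colAux := [], col := w.reverse ++ S.col }) := by
  induction w generalizing S with
  | nil => exact .head (.refl _)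
  | cons b w ih =>
    refine .head (S' := { S with colAux := w, col := b :: S.col }) (q' := q) ?_
    simpa using ih { S with col := b :: S.col }

theorem within_backRow (q : Phase) (w : List VertexMark) (S : Stacks) :
    Within (w.length + 1) (cfg .backRow q { S with rowAux := w })
      (cfg .backMat q { S with rowAux := [], row := w.reverse ++ S.row }) := by
  induction w generalizing S with
  | nil => exact .head (.refl _)
  | cons b w ih =>
    refine .head (S' := { S with rowAux := w, row := b :: S.row }) (q' := q) ?_
    simpa using ih { S with row := b :: S.row }

theorem within_backMat (q : Phase) (w : List Cell) (S : Stacks) :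
    Within (w.length + 1) (cfg .backMat q { S with matAux := w })
      (cfg (if q.next = done then .clean else .sweepRow) q.next
        { S with matAux := [], mat := w.reverse ++ S.mat }) := by
  induction w generalizing S with
  | nil =>
    cases q with
    | mark b => cases b <;> exact .head (.refl _)
    | _ => exact .head (.refl _)
  | cons b w ih =>
    refine .head (S' := { S with matAux := w, mat := b :: S.mat }) (q' := q) ?_
    simpa using ih { S with mat := b :: S.mat }

theorem within_carry (q : Phase) (w : List Bool) (S : Stacks) :
    Within (w.length + 1) (cfg .carry q { S with tmp := w })
      (cfg .count q { S with tmp := [], out := w.reverse ++ S.out }) := by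
  induction w generalizing S with
  | nil => exact .head (.refl _)
  | cons b w ih =>
    refine .head (S' := { S with tmp := w, out := b :: S.out }) (q' := q) ?_
    simpa using ih { S with out := b :: S.out }

/-- The number with the given bits, the lowest one first. -/
def bitsVal : List Bool → ℕ
  | [] => 0
  | b :: l => b.toNat + 2 * bitsVal l

/-- Subtract one from a positive binary number. -/
def decBits : List Bool → List Bool
  | [] => []
  | true :: l => false :: l
  | false :: l => true :: decBits l

/-- Add one to a binary number. -/
def incBits : List Bool → List Bool
  | [] => [true]
  | false :: l => true :: l
  | true :: l => false :: incBits l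

theorem length_decBits (l : List Bool) : (decBits l).length = l.length := by
  induction l with
  | nil => rfl
  | cons b l ih => cases b <;> simp [decBits, ih]

theorem bitsVal_decBits {l : List Bool} (h : bitsVal l ≠ 0) :
    bitsVal (decBits l) = bitsVal l - 1 := by
  induction l with
  | nil => exact absurd rfl h
  | cons b l ih =>
    cases b
    · simp only [bitsVal, decBits, Bool.toNat_false, Bool.toNat_true, zero_add] at h ⊢
      have := ih (by omega)
      omega
    · simp [bitsVal, decBits]

theorem length_incBits (l : List Bool) : (incBits l).length ≤ l.length + 1 := by
  induction l with
  | nil => simp [incBits]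
  | cons b l ih => cases b <;> simp [incBits, ih]

theorem within_borrow_zero (q : Phase) (K T : List Bool) (hK : bitsVal K = 0) (S : Stacks) :
    Within (2 * K.length + T.length + 2) (cfg .borrow q { S with cnt := K, tmp := T })
      (cfg .dec q { S with
        cnt := [], tmp := [], row := fresh :: S.row, col := fresh :: S.col }) := by
  induction K generalizing T with
  | nil =>
    exact (Within.head (S' := { S with cnt := [], tmp := T }) (q' := q)
      (within_zero q T { S with cnt := [] })).mono (by simp)
  | cons b K ih =>
    cases b
    · exact (Within.head (S' := { S with cnt := K, tmp := true :: T }) (q' := q)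
        (ih (true :: T) (by simpa [bitsVal] using hK))).mono (by simp; omega)
    · simp [bitsVal] at hK

theorem within_borrow_pos (q : Phase) (K T : List Bool) (hK : bitsVal K ≠ 0) (S : Stacks) :
    Within (2 * K.length + T.length + 2) (cfg .borrow q { S with cnt := K, tmp := T })
      (cfg .dec q { S with
        cnt := T.reverse ++ decBits K, tmp := [], row := full :: S.row, col := full :: S.col }) := by
  induction K generalizing T with
  | nil => exact absurd rfl hK
  | cons b K ih =>
    cases b
    · have := ih (true :: T) (by simpa [bitsVal] using hK)
      simp only [List.reverse_cons, List.append_assoc, List.singleton_append] at this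
      exact (Within.head (S' := { S with cnt := K, tmp := true :: T }) (q' := q) this).mono
        (by simp; omega)
    · exact (Within.head (S' := { S with cnt := false :: K, tmp := T }) (q' := q)
        (within_restore q T { S with cnt := false :: K })).mono (by simp)

/-- Only the number of `full` labels matters later, not their positions. Decrementing never
lengthens the counter word, which gives a uniform cost per mark. -/
theorem within_dec (q : Phase) (w : List VertexMark) (K : List Bool) (S : Stacks) :
    ∃ (L : List VertexMark) (K' : List Bool), L.length = w.length ∧ K'.length ≤ K.length ∧
      (∀ v ∈ L, v ≠ active) ∧ L.countP (· = full) = min (bitsVal K) w.length ∧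
      Within (w.length * (2 * K.length + 3) + 1)
        (cfg .dec q { S with rowAux := w, cnt := K, tmp := [] })
        (cfg .backMat q { S with
          rowAux := [], cnt := K', tmp := [], row := L ++ S.row, col := L ++ S.col }) := by
  induction w generalizing K S with
  | nil => exact ⟨[], K, rfl, le_rfl, by simp, by simp, (Within.head (.refl _)).mono (by simp)⟩
  | cons v w ih =>
    by_cases hK : bitsVal K = 0
    · obtain ⟨L, K', h1, h2, h3, h4, h5⟩ := ih [] { S with row := fresh :: S.row, col := fresh :: S.col }
      refine ⟨L ++ [fresh], K', by simp [h1], h2.trans (by simp), ?_, ?_, ?_⟩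
      · simpa [or_imp, forall_and] using h3
      · simp [h4, hK, bitsVal]
      · have := (Within.head (l := .dec) (S := { S with rowAux := v :: w, cnt := K, tmp := [] })
          (S' := { S with rowAux := w, cnt := K, tmp := [] }) (q := q) (q' := q)
          (within_borrow_zero q K [] hK { S with rowAux := w })).trans h5
        simp only [List.append_assoc, List.singleton_append]
        refine this.mono ?_
        simp only [List.length_nil, List.length_cons]
        nlinarith [Nat.zero_le (w.length * K.length)]
    · obtain ⟨L, K', h1, h2, h3, h4, h5⟩ :=
        ih (decBits K) { S with row := full :: S.row, col := full :: S.col }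
      rw [length_decBits] at h2 h5
      refine ⟨L ++ [full], K', by simp [h1], h2, ?_, ?_, ?_⟩
      · simpa [or_imp, forall_and] using h3
      · simp [h4, bitsVal_decBits hK]
        omega
      · have := (Within.head (l := .dec) (S := { S with rowAux := v :: w, cnt := K, tmp := [] })
          (S' := { S with rowAux := w, cnt := K, tmp := [] }) (q := q) (q' := q)
          (within_borrow_pos q K [] hK { S with rowAux := w })).trans h5
        simp only [List.append_assoc, List.singleton_append]
        refine this.mono ?_
        simp only [List.length_nil, List.length_cons]
        nlinarith [Nat.zero_le (w.length * K.length)]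

end Machine

/-! ### Sweeps on the machine, and binary counting of the result. -/

section Machine

open VertexMark Phase Turing

namespace SweepState

variable {n : ℕ}

/-- The rows in `l` of the working matrix. -/
def rowsOf (st : SweepState n) (l : List (Fin n)) : List Cell :=
  l.flatMap fun i => (List.finRange n).map (st.m i)

/-- The stacks at the beginning of a row: the rows in `d` are done, those in `l` are left. -/
def stacksAt (st : SweepState n) (K : List Bool) (d l : List (Fin n)) : Stacks where
  row := l.map st.r
  rowAux := (d.map st.r).reverse
  col := (List.finRange n).map st.c
  mat := st.rowsOf l
  matAux := (st.rowsOf d).reverse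
  cnt := K

/-- The stacks during row `i`: the columns in `e` are done, those in `f` are left. -/
def stacksIn (st : SweepState n) (K : List Bool) (d : List (Fin n)) (i : Fin n)
    (l e f : List (Fin n)) : Stacks where
  row := st.r i :: l.map st.r
  rowAux := (d.map st.r).reverse
  col := f.map st.c
  colAux := (e.map st.c).reverse
  mat := f.map (st.m i) ++ st.rowsOf l
  matAux := (e.map (st.m i)).reverse ++ (st.rowsOf d).reverse
  cnt := K

theorem map_set_r (st : SweepState n) (i j o) {l : List (Fin n)} (h : i ∉ l) :
    l.map (st.set i j o).r = l.map st.r :=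
  List.map_congr_left fun i' hi' => by
    rw [set_r, if_neg]
    rintro rfl
    exact h hi'

theorem map_set_c (st : SweepState n) (i j o) {l : List (Fin n)} (h : j ∉ l) :
    l.map (st.set i j o).c = l.map st.c :=
  List.map_congr_left fun j' hj' => by
    rw [set_c, if_neg]
    rintro rfl
    exact h hj'

theorem map_set_m (st : SweepState n) (i j o) {l : List (Fin n)} (h : j ∉ l) :
    l.map ((st.set i j o).m i) = l.map (st.m i) :=
  List.map_congr_left fun j' hj' => by
    rw [set_m, if_neg]
    rintro ⟨-, rfl⟩
    exact h hj'

theorem rowsOf_set (st : SweepState n) (i j o) {l : List (Fin n)} (h : i ∉ l) :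
    (st.set i j o).rowsOf l = st.rowsOf l := by
  unfold rowsOf
  refine congrArg List.flatten (List.map_congr_left fun i' hi' => ?_)
  refine List.map_congr_left fun j' _ => ?_
  rw [set_m, if_neg]
  rintro ⟨rfl, -⟩
  exact h hi'

/-- Absence of duplicates ensures that a visit to `(i, j)` alters only the symbols being moved, not
those deeper in the stacks. -/
theorem within_entry (st : SweepState n) (K : List Bool) {d l e f : List (Fin n)} {i : Fin n}
    (hd : (d ++ i :: l).Nodup) (he : (e ++ f).Nodup) :
    Within (f.length + 1) (cfg .entry st.ph (st.stacksIn K d i l e f))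
      (cfg .backCol (st.sweepRow i f).ph
        { (st.sweepRow i f).stacksIn K d i l (e ++ f) [] with
          row := l.map (st.sweepRow i f).r
          rowAux := (st.sweepRow i f).r i :: (d.map (st.sweepRow i f).r).reverse }) := by
  induction f generalizing st e with
  | nil =>
    rw [List.append_nil]
    exact .head (.refl _)
  | cons j f ih =>
    have hj : j ∉ e ∧ j ∉ f := by
      rw [List.nodup_append] at he
      exact ⟨fun h => he.2.2 j h j (by simp) rfl, (List.nodup_cons.1 he.2.1).1⟩
    have hi : i ∉ d ∧ i ∉ l := by
      rw [List.nodup_append] at hd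
      exact ⟨fun h => hd.2.2 i h i (by simp) rfl, (List.nodup_cons.1 hd.2.1).1⟩
    have key := ih (st.step i j) (e := e ++ [j]) (by simpa using he)
    rw [List.append_assoc, List.singleton_append] at key
    refine Within.head key rfl rfl ?_
    intro k
    have h1 := map_set_r st i j (localStep st.ph (st.r i) (st.c j) (st.m i j)) hi.1
    have h2 := map_set_r st i j (localStep st.ph (st.r i) (st.c j) (st.m i j)) hi.2
    have h3 := map_set_c st i j (localStep st.ph (st.r i) (st.c j) (st.m i j)) hj.1
    have h4 := map_set_c st i j (localStep st.ph (st.r i) (st.c j) (st.m i j)) hj.2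
    have h5 := map_set_m st i j (localStep st.ph (st.r i) (st.c j) (st.m i j)) hj.1
    have h6 := map_set_m st i j (localStep st.ph (st.r i) (st.c j) (st.m i j)) hj.2
    have h7 := rowsOf_set st i j (localStep st.ph (st.r i) (st.c j) (st.m i j)) hi.1
    have h8 := rowsOf_set st i j (localStep st.ph (st.r i) (st.c j) (st.m i j)) hi.2
    cases k
    case row => simp [stacksIn, Stacks.get, step, h2, set_r]; rfl
    case rowAux => simp [stacksIn, Stacks.get, step, h1]; rfl
    case col => simp [stacksIn, Stacks.get, step, h4]; rfl
    case colAux => simp [stacksIn, Stacks.get, step, h3, set_c]; rfl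
    case mat => simp [stacksIn, Stacks.get, step, h6, h8]; rfl
    case matAux => simp [stacksIn, Stacks.get, step, h5, h7, set_m]; rfl
    all_goals rfl

theorem within_rows (st : SweepState n) (K : List Bool) {d l : List (Fin n)}
    (hd : (d ++ l).Nodup) :
    Within (l.length * (2 * n + 3) + 1) (cfg .sweepRow st.ph (st.stacksAt K d l))
      (cfg .backRow (st.sweepRows l).ph ((st.sweepRows l).stacksAt K (d ++ l) [])) := by
  induction l generalizing st d with
  | nil =>
    rw [List.append_nil]
    exact (Within.head (.refl _)).mono (by simp)
  | cons i l ih =>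
    have h1 := within_entry st K hd (e := []) (f := List.finRange n)
      (by simpa using List.nodup_finRange n)
    rw [List.nil_append] at h1
    set s := st.sweepRow i (List.finRange n)
    have h2 := within_backCol s.ph ((List.finRange n).map s.c).reverse
      { s.stacksAt K (d ++ [i]) l with col := [] }
    have h3 := ih s (d := d ++ [i]) (by simpa using hd)
    have e1 : ({ s.stacksIn K d i l (List.finRange n) [] with
        row := l.map s.r, rowAux := s.r i :: (d.map s.r).reverse } : Stacks) =
        { s.stacksAt K (d ++ [i]) l with
          col := [], colAux := ((List.finRange n).map s.c).reverse } := by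
      simp [stacksIn, stacksAt, rowsOf]
    have e2 : ({ s.stacksAt K (d ++ [i]) l with
        colAux := [], col := ((List.finRange n).map s.c).reverse.reverse ++ [] } : Stacks) =
        s.stacksAt K (d ++ [i]) l := by
      simp [stacksAt]
    rw [e1] at h1
    rw [e2] at h2
    rw [List.append_assoc, List.singleton_append] at h3
    -- A row costs one step for the emptiness test and `n + 1` each for the pass and for restoring
    -- the columns, in all `2 * n + 3`.
    refine (Within.head ((h1.trans h2).trans h3) rfl rfl ?_).mono ?_
    · intro k
      cases k <;> rfl
    · simp
      ring_nf
      omega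

/-- One sweep of the machine. -/
theorem within_sweep (st : SweepState n) (K : List Bool) :
    Within (n * (2 * n + 3) + n + n * n + 3)
      (cfg .sweepRow st.ph (st.stacksAt K [] (List.finRange n)))
      (cfg (if st.sweep.ph = done then .clean else .sweepRow) st.sweep.ph
        (st.sweep.stacksAt K [] (List.finRange n))) := by
  have h1 := within_rows st K (d := []) (l := List.finRange n)
    (by simpa using List.nodup_finRange n)
  rw [List.nil_append] at h1
  set s := st.sweepRows (List.finRange n) with hs
  have h2 := within_backRow s.ph ((List.finRange n).map s.r).reverse
    (s.stacksAt K (List.finRange n) [])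
  have h3 := within_backMat s.ph (s.rowsOf (List.finRange n)).reverse
    { s.stacksAt K [] (List.finRange n) with mat := [] }
  have e1 : ({ s.stacksAt K (List.finRange n) [] with
      rowAux := ((List.finRange n).map s.r).reverse } : Stacks) =
      s.stacksAt K (List.finRange n) [] := rfl
  have e2 : ({ s.stacksAt K (List.finRange n) [] with
      rowAux := [], row := ((List.finRange n).map s.r).reverse.reverse ++
        (s.stacksAt K (List.finRange n) []).row } : Stacks) =
      { s.stacksAt K [] (List.finRange n) with
        mat := [], matAux := (s.rowsOf (List.finRange n)).reverse } := by
    simp [stacksAt, rowsOf]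
  have e3 : ({ s.stacksAt K [] (List.finRange n) with
      matAux := [], mat := (s.rowsOf (List.finRange n)).reverse.reverse ++ [] } : Stacks) =
      st.sweep.stacksAt K [] (List.finRange n) := by
    simp [stacksAt, rowsOf, sweep, ← hs, endSweep]
  rw [e1, e2] at h2
  rw [e3] at h3
  refine ((h1.trans h2).trans h3).mono ?_
  have : (s.rowsOf (List.finRange n)).length = n * n := by simp [rowsOf]
  simp [this]
  omega

/-- The main loop of the machine. -/
theorem within_loop {A : Fin n → Fin n → Bool} {k : ℕ} {st : SweepState n} (h : st.Inv A k)
    (hm : st.ph ≠ mark true) (hd : st.ph ≠ done) (K : List Bool) :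
    ∃ st' : SweepState n, st'.Inv A k ∧ st'.ph = done ∧
      Within (st.potential * (n * (2 * n + 3) + n + n * n + 3))
        (cfg .sweepRow st.ph (st.stacksAt K [] (List.finRange n)))
        (cfg .clean done (st'.stacksAt K [] (List.finRange n))) := by
  generalize hp : st.potential = p
  induction p using Nat.strong_induction_on generalizing st with
  | _ p ih =>
    obtain ⟨h1, h2, h3⟩ := inv_sweep h hm hd
    have h4 := within_sweep st K
    by_cases h5 : st.sweep.ph = done
    · refine ⟨st.sweep, h1, h5, ?_⟩
      rw [if_pos h5, h5] at h4
      exact h4.mono (Nat.le_mul_of_pos_left _ (by omega))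
    · rw [if_neg h5] at h4
      obtain ⟨st', h6, h7, h8⟩ := ih st.sweep.potential (by omega) h1 h2 h5 rfl
      refine ⟨st', h6, h7, (h4.trans h8).mono ?_⟩
      rw [add_comm, ← Nat.succ_mul]
      exact Nat.mul_le_mul_right _ (by omega)

end SweepState

theorem within_clean (q : Phase) (S : Stacks) :
    Within (S.row.length + S.col.length + S.cnt.length + 1) (cfg .clean q S)
      (cfg .count q { S with row := [], col := [], cnt := [] }) := by
  generalize hN : S.row.length + S.col.length + S.cnt.length = N
  induction N using Nat.strong_induction_on generalizing S with
  | _ N ih =>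
    obtain ⟨inp, out, row, rowAux, col, colAux, mat, matAux, cnt, tmp⟩ := S
    simp only at hN ih ⊢
    by_cases h : row = [] ∧ col = [] ∧ cnt = []
    · obtain ⟨rfl, rfl, rfl⟩ := h
      exact (Within.head (.refl _)).mono (by omega)
    · have key := ih (row.tail.length + col.tail.length + cnt.tail.length)
        (by
          rcases row with _ | ⟨a, row⟩ <;> rcases col with _ | ⟨b, col⟩ <;>
            rcases cnt with _ | ⟨c, cnt⟩ <;> simp at h hN ⊢ <;> omega)
        ⟨inp, out, row.tail, rowAux, col.tail, colAux, mat, matAux, cnt.tail, tmp⟩ rfl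
      have hlt : row.tail.length + col.tail.length + cnt.tail.length + 1 ≤ N := by
        rcases row with _ | ⟨a, row⟩ <;> rcases col with _ | ⟨b, col⟩ <;>
          rcases cnt with _ | ⟨c, cnt⟩ <;> simp at h hN ⊢ <;> omega
      rcases row with _ | ⟨a, row⟩ <;> rcases col with _ | ⟨b, col⟩ <;>
        rcases cnt with _ | ⟨c, cnt⟩
      · simp at h
      all_goals exact (Within.head key).mono (by omega)

theorem within_inc (q : Phase) (w T : List Bool) (S : Stacks) :
    Within (2 * w.length + T.length + 2) (cfg .inc q { S with out := w, tmp := T })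
      (cfg .count q { S with out := T.reverse ++ incBits w, tmp := [] }) := by
  induction w generalizing T with
  | nil =>
    exact (Within.head (S' := { S with out := [true], tmp := T }) (q' := q)
      (within_carry q T { S with out := [true] })).mono (by simp)
  | cons b w ih =>
    cases b
    · exact (Within.head (S' := { S with out := true :: w, tmp := T }) (q' := q)
        (within_carry q T { S with out := true :: w })).mono (by simp)
    · have := ih (false :: T)
      simp only [List.reverse_cons, List.append_assoc, List.singleton_append] at this
      exact (Within.head (S' := { S with out := w, tmp := false :: T }) (q' := q) this).mono
        (by simp; omega)

theorem encodeNat_succ (m : ℕ) :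
    Computability.encodeNat (m + 1) = incBits (Computability.encodeNat m) := by
  have key : ∀ p : PosNum, Computability.encodePosNum p.succ =
      incBits (Computability.encodePosNum p) := by
    intro p
    induction p with
    | one => rfl
    | bit1 p ih => simp [PosNum.succ, Computability.encodePosNum, incBits, ih]
    | bit0 p ih => simp [PosNum.succ, Computability.encodePosNum, incBits]
  unfold Computability.encodeNat
  rw [Nat.cast_succ, Num.add_one]
  rcases (m : Num) with _ | p
  · rfl
  · exact key p

theorem length_encodeNat_le (m : ℕ) : (Computability.encodeNat m).length ≤ m := by
  induction m with
  | zero => simp [Computability.encodeNat, Computability.encodeNum]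
  | succ m ih =>
    rw [encodeNat_succ]
    exact (length_incBits _).trans (by omega)

/-- Dropping the lowest bit halves an even number; for zero the word is empty, and so is its tail.
-/
theorem tail_encodeNat_two_mul (m : ℕ) :
    (Computability.encodeNat (2 * m)).tail = Computability.encodeNat m := by
  have h0 : Computability.encodeNat 0 = [] := rfl
  have key : m = 0 ∨ Computability.encodeNat (2 * m) = false :: Computability.encodeNat m := by
    induction m with
    | zero => exact Or.inl rfl
    | succ m ih =>
      right
      rw [Nat.mul_succ, encodeNat_succ, encodeNat_succ, encodeNat_succ m]
      rcases ih with rfl | ih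
      · simp [h0, incBits]
      · rw [ih]
        rfl
  rcases key with rfl | h
  · rfl
  · rw [h]
    rfl

/-- `B` bounds the running count, hence crudely also the length of its binary word, so an increment
with its test takes at most `2 * B + 3` steps. -/
theorem within_count (q : Phase) (w : List Cell) (a B : ℕ) (hB : a + w.length ≤ B) (S : Stacks) :
    Within (w.length * (2 * B + 3) + 1)
      (cfg .count q { S with mat := w, out := Computability.encodeNat a, tmp := [] })
      (cfg .final q { S with
        mat := [], out := Computability.encodeNat (a + (w.map fun m => m.x.toNat).sum),
        tmp := [] }) := by
  induction w generalizing a with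
  | nil => exact (Within.head (.refl _)).mono (by simp)
  | cons m w ih =>
    rw [List.length_cons] at hB
    obtain ⟨ma, mx, my, mz, mp⟩ := m
    cases mx
    · refine (Within.head (S' := { S with
        mat := w, out := Computability.encodeNat a, tmp := [] }) (q' := q)
        (by simpa using ih a (by omega))).mono ?_
      simp only [List.length_cons]
      nlinarith
    · have h1 := within_inc q (Computability.encodeNat a) [] { S with mat := w }
      rw [← encodeNat_succ] at h1
      have h2 := h1.trans (ih (a + 1) (by omega))
      refine (Within.head (S' := { S with
        mat := w, out := Computability.encodeNat a, tmp := [] }) (q' := q)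
        (by simpa [add_assoc] using h2)).mono ?_
      have := length_encodeNat_le a
      simp only [List.length_cons]
      nlinarith

end Machine

/-! ### Reading the encoded input, and the total running time. -/

section Machine

open VertexMark Phase Turing

theorem bitsVal_encodeNat (k : ℕ) : bitsVal (Computability.encodeNat k) = k := by
  have key : ∀ l, bitsVal (incBits l) = bitsVal l + 1 := by
    intro l
    induction l with
    | nil => rfl
    | cons b l ih =>
      cases b <;> simp only [incBits, bitsVal, Bool.toNat_false, Bool.toNat_true, ih] <;> omega
  induction k with
  | zero => rfl
  | succ k ih => rw [encodeNat_succ, key, ih]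

theorem exists_map_finRange_eq {α : Type*} {n : ℕ} (L : List α) (h : L.length = n) :
    ∃ v : Fin n → α, (List.finRange n).map v = L := by
  subst h
  exact ⟨L.get, by simp⟩

open scoped Classical in
/-- The adjacency matrix as a Boolean function. -/
noncomputable def adjBool {n : ℕ} (G : SimpleGraph (Fin n)) (i j : Fin n) : Bool :=
  decide (G.Adj i j)

theorem encodeInput_length (x : BipartiteGraph × ℕ) :
    (encodeInput x).length =
      x.1.n * (x.1.n + 1) + (Computability.encodeNat x.2).length := by
  simp [encodeInput, encodeGraph]

theorem filterMap_symCell_encodeInput (x : BipartiteGraph × ℕ) (v : Fin x.1.n → VertexMark) :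
    (encodeInput x).filterMap symCell =
      (SweepState.initial (adjBool x.1.graph) v).rowsOf (List.finRange x.1.n) := by
  have h1 : ∀ l : List Bool, (l.map Sum.inr).filterMap symCell = [] := by
    intro l
    simp [List.filterMap_map, Function.comp_def, symCell]
  have h2 : ∀ l : List Bool, (l.map fun b => Sum.inl (some b)).filterMap symCell =
      l.map fun b => ⟨b, false, false, false, false⟩ := by
    intro l
    simp [List.filterMap_map, Function.comp_def, symCell]
  rw [encodeInput, List.filterMap_append, h1, List.append_nil, encodeGraph, SweepState.rowsOf,
    List.map_flatMap, List.filterMap_flatMap]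
  refine congrArg List.flatten (List.map_congr_left fun i _ => ?_)
  have h3 := h2 ((List.finRange x.1.n).map fun j => adjBool x.1.graph i j)
  simp only [List.map_map, Function.comp_def] at h3
  simp only [List.map_append, List.map_map, List.filterMap_append, Function.comp_def]
  refine (congrArg₂ _ h3 rfl).trans ?_
  simp [SweepState.initial, symCell]

theorem length_filterMap_symRow_encodeInput (x : BipartiteGraph × ℕ) :
    ((encodeInput x).filterMap symRow).length = x.1.n := by
  have h1 : ∀ l : List Bool, (l.map Sum.inr).filterMap symRow = [] := by
    intro l
    simp [List.filterMap_map, Function.comp_def, symRow]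
  have h2 : ∀ l : List (Option Bool), ((l.map Sum.inl).filterMap symRow).length =
      l.countP Option.isNone := by
    intro l
    induction l with
    | nil => rfl
    | cons a l ih => cases a <;> simpa [List.filterMap_cons, symRow] using ih
  rw [encodeInput, List.filterMap_append, h1, List.append_nil, h2, encodeGraph_count_none]

theorem filterMap_getRight_encodeInput (x : BipartiteGraph × ℕ) :
    (encodeInput x).filterMap Sum.getRight? = Computability.encodeNat x.2 := by
  simp [encodeInput, List.filterMap_append, List.filterMap_map, Function.comp_def]

theorem sum_rowsOf {n : ℕ} (w : Cell → ℕ) (st : SweepState n) :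
    ((st.rowsOf (List.finRange n)).map w).sum = st.total w := by
  simp [SweepState.rowsOf, SweepState.total, List.flatMap, List.map_flatten, List.sum_flatten,
    Fin.sum_univ_def, Function.comp_def]

theorem countP_finRange {n : ℕ} (v : Fin n → VertexMark) :
    ((List.finRange n).map v).countP (· = full) =
      (Finset.univ.filter fun i => v i = full).card := by
  rw [List.countP_map, List.countP_eq_length_filter]
  rfl

/-- The machine computing `ν_k` of bipartite graphs. -/
noncomputable def nuMachine : FinTM2 where
  K := Stk
  k₀ := .inp
  k₁ := .out
  Γ := Alphabet
  Λ := Label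
  main := .parse
  σ := Memory
  initialState := .idle start
  Γk₀Fin := inferInstanceAs (Fintype (Option Bool ⊕ Bool))
  m := program

open Polynomial in
/-- The running time of the machine. -/
noncomputable def nuTime : Polynomial ℕ :=
  -- The summands bound, in order: parsing and reversing the counter, the initial labels, reversing
  -- the matrix, the first sweep, potential times cost of a sweep, cleaning, counting, and the final
  -- step. They use that `n * n`, `n` and the length of `k` are at most the input length.
  2 * (X + 1) + (X * (2 * X + 3) + 1) + (X + 1) + (7 * X + 3) +
    (X * (3 * X + 6) + 3 * X + 4) * (7 * X + 3) + (3 * X + 1) + (X * (2 * X + 3) + 1) + 1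

theorem within_nu (x : BipartiteGraph × ℕ) :
    Within (nuTime.eval (encodeInput x).length)
      (cfg .parse start { inp := encodeInput x })
      ⟨none, .idle start,
        ({ out := Computability.encodeNat (nu x.2 x.1.graph) } : Stacks).get⟩ := by
  set N := (encodeInput x).length with hN
  have hlen := encodeInput_length x
  have hcell := filterMap_symCell_encodeInput x
  have hrow := length_filterMap_symRow_encodeInput x
  have hbits := filterMap_getRight_encodeInput x
  generalize encodeInput x = w at *
  obtain ⟨⟨n, G, hG⟩, k⟩ := x
  dsimp only at *
  rw [← hN] at hlen
  have hn2 : n * n ≤ N := by nlinarith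
  have hn : n ≤ N := by nlinarith
  have hb : (Computability.encodeNat k).length ≤ N := by omega
  have t1 := within_parse start w {}
  rw [hbits] at t1
  simp only [List.append_nil] at t1
  have t2 := within_revCnt start (Computability.encodeNat k).reverse
    { matAux := (w.filterMap symCell).reverse, rowAux := (w.filterMap symRow).reverse }
  rw [List.reverse_reverse, List.append_nil, List.length_reverse] at t2
  obtain ⟨L, K', hL, hK', hLa, hLf, t3⟩ := within_dec start (w.filterMap symRow).reverse
    (Computability.encodeNat k) { matAux := (w.filterMap symCell).reverse }
  rw [List.length_reverse, hrow] at hL hLf t3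
  rw [bitsVal_encodeNat] at hLf
  simp only [List.append_nil] at t3
  obtain ⟨v, rfl⟩ := exists_map_finRange_eq L hL
  rw [countP_finRange] at hLf
  have t4 := within_backMat start (w.filterMap symCell).reverse
    { row := (List.finRange n).map v, col := (List.finRange n).map v, cnt := K' }
  rw [List.reverse_reverse, List.length_reverse, List.append_nil, hcell v] at t4
  rw [hcell v] at t1 t2 t3
  set s0 := SweepState.initial (adjBool G) v
  have hs0 : (s0.rowsOf (List.finRange n)).length = n * n := by simp [SweepState.rowsOf]
  rw [hs0, show start.next = init from rfl, if_neg (by decide)] at t4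
  obtain ⟨hI, hph⟩ : s0.sweep.Inv (adjBool G) (min k n) ∧ s0.sweep.ph = clear := SweepState.inv_sweep_initial (adjBool G) v
    (fun i => hLa _ (List.mem_map.2 ⟨i, List.mem_finRange i, rfl⟩)) hLf
  have t5 := SweepState.within_sweep s0 K'
  rw [hph, if_neg (by decide)] at t5
  obtain ⟨s1, hI1, hd, t6⟩ := SweepState.within_loop hI (by rw [hph]; decide)
    (by rw [hph]; decide) K'
  rw [hph] at t6
  have t7 := within_clean done (s1.stacksAt K' [] (List.finRange n))
  have hout := SweepState.total_eq_two_mul_nu hG (fun i j => by simp [adjBool]) hI1 hd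
  have hs1 : (s1.rowsOf (List.finRange n)).length = n * n := by simp [SweepState.rowsOf]
  have t8 := within_count done (s1.rowsOf (List.finRange n)) 0 (n * n) (by omega) {}
  rw [sum_rowsOf, hout, zero_add, hs1] at t8
  have t9 : ∀ w : List Bool, Within 1 (cfg .final done { out := w })
      ⟨none, .idle start, ({ out := w.tail } : Stacks).get⟩ := by
    refine fun w => ⟨1, le_rfl, congrArg some ?_⟩
    change (⟨none, .idle start, _⟩ : TM2.Cfg Alphabet Label Memory) = _
    congr 1
    funext k
    cases k <;> rfl
  have t9 := t9 (Computability.encodeNat (2 * nu k G))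
  rw [tail_encodeNat_two_mul] at t9
  have hpot : s0.sweep.potential ≤ N * (3 * N + 6) + 3 * N + 4 := by
    have h1 : (s0.sweep.total fun m => m.y.toNat) ≤ N :=
      (SweepState.total_le (fun m => m.y.toNat_le) _).trans hn2
    have h2 := Nat.mul_le_mul h1 (show n * n + 2 * n + 6 ≤ 3 * N + 6 by omega)
    simp only [SweepState.potential, hph]
    omega
  have hsw : n * (2 * n + 3) + n + n * n + 3 ≤ 7 * N + 3 := by nlinarith
  have hdec : n * (2 * (Computability.encodeNat k).length + 3) ≤ N * (2 * N + 3) :=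
    Nat.mul_le_mul hn (by omega)
  have hcount : n * n * (2 * (n * n) + 3) ≤ N * (2 * N + 3) := Nat.mul_le_mul hn2 (by omega)
  have hloop := Nat.mul_le_mul hpot hsw
  refine ((((((((t1.trans t2).trans t3).trans t4).trans t5).trans t6).trans t7).trans t8).trans
    t9).mono ?_
  have hst : (s1.stacksAt K' [] (List.finRange n)).row.length = n ∧
      (s1.stacksAt K' [] (List.finRange n)).col.length = n ∧
      (s1.stacksAt K' [] (List.finRange n)).cnt.length = K'.length := by
    simp [SweepState.stacksAt]
  simp only [nuTime, Polynomial.eval_add, Polynomial.eval_mul, Polynomial.eval_X,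
    Polynomial.eval_ofNat, Polynomial.eval_one]
  omega

end Machine

theorem mainTheorem4 :
    PolyTimeComputable encodeInput Computability.encodeNat
      (fun x : BipartiteGraph × ℕ => nu x.2 x.1.graph) := by
  have key : ∀ x : BipartiteGraph × ℕ, Nonempty (Turing.TM2OutputsInTime nuMachine
      (List.map (Equiv.refl (Option Bool ⊕ Bool)).invFun (encodeInput x))
      (some (List.map (Equiv.refl Bool).invFun (Computability.encodeNat (nu x.2 x.1.graph))))
      (nuTime.eval (encodeInput x).length)) := by
    intro x
    obtain ⟨s, hs, e⟩ := within_nu x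
    have h1 : Turing.initList nuMachine (encodeInput x) =
        cfg .parse .start { inp := encodeInput x } := by
      change (⟨_, _, _⟩ : Turing.TM2.Cfg Alphabet Label Memory) = ⟨_, _, _⟩
      congr 1
      funext k
      cases k <;> rfl
    have h2 : Turing.haltList nuMachine (Computability.encodeNat (nu x.2 x.1.graph)) =
        ⟨none, .idle .start,
          ({ out := Computability.encodeNat (nu x.2 x.1.graph) } : Stacks).get⟩ := by
      change (⟨_, _, _⟩ : Turing.TM2.Cfg Alphabet Label Memory) = ⟨_, _, _⟩
      congr 1
      funext k
      cases k <;> rfl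
    refine ⟨⟨⟨s, ?_⟩, hs⟩⟩
    have h3 : List.map (Equiv.refl (Option Bool ⊕ Bool)).invFun (encodeInput x) = encodeInput x :=
      List.map_id _
    have h4 : List.map (Equiv.refl Bool).invFun (Computability.encodeNat (nu x.2 x.1.graph)) =
      Computability.encodeNat (nu x.2 x.1.graph) := List.map_id _
    have h5 := (congrArg (Turing.initList nuMachine) h3).trans h1
    have h6 := congrArg some ((congrArg (Turing.haltList nuMachine) h4).trans h2)
    exact (congrArg (fun c => (flip bind (Turing.TM2.step program))^[s] (some c)) h5).trans
      (e.trans h6.symm)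
  refine ⟨{
    tm := nuMachine
    inputAlphabet := Equiv.refl (Option Bool ⊕ Bool)
    outputAlphabet := Equiv.refl Bool
    time := nuTime
    outputsFun := fun x => (key x).some }, ?_⟩
  rintro (_ | _ | _ | _ | _ | _ | _ | _ | _ | _)
  · exact inferInstanceAs (Finite (Option Bool ⊕ Bool))
  · exact inferInstanceAs (Finite Bool)
  · exact inferInstanceAs (Finite VertexMark)
  · exact inferInstanceAs (Finite VertexMark)
  · exact inferInstanceAs (Finite VertexMark)
  · exact inferInstanceAs (Finite VertexMark)
  · exact inferInstanceAs (Finite Cell)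
  · exact inferInstanceAs (Finite Cell)
  · exact inferInstanceAs (Finite Bool)
  · exact inferInstanceAs (Finite Bool)
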